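/- **Setting.** Let $G$ be a Lie group with Lie algebra $\mathfrak g$, acting smoothly from the right on a manifold $M$ by $\vartheta_g\colon M\to M$ ($g\in G$), and let $x\mapsto v_x$, $v_x(m)=\frac{d}{dt}\big|_{0}\vartheta_{\exp(tx)}(m)$, be the corresponding infinitesimal action. For $p=x_1\wedge\dots\wedge x_k$ put $v_p=v_{x_1}\wedge\dots\wedge v_{x_k}$ and $\iota(v_p)=\iota_{v_{x_k}}\cdots\iota_{v_{x_1}}$, and extend linearly to $p\in\Lambda^k\mathfrak g$. Let $\varsigma(k)=-(-1)^{k(k+1)/2}$, let $$\partial(x_1\wedge\dots\wedge x_k)=\sum_{1\le i<j\le k}(-1)^{i+j}[x_i,x_j]\wedge x_1\wedge\dots\wedge\hat x_i\wedge\dots\wedge\hat x_j\wedge\dots\wedge x_k$$ be the Lie algebra homology differential, and $Z_k(\mathfrak g)=\ker(\partial|_{\Lambda^k\mathfrak g})$. A *pre-$n$-plectic manifold* $(M,\omega)$ is a manifold with a closed form $\omega\in\Omega^{n+1}(M)$. A *co-momentum map* for an infinitesimal action $v\colon\mathfrak h\to\mathfrak X(M)$ of a Lie algebra $\mathfrak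 h$ (a Lie algebra homomorphism) that is multisymplectic, i.e. satisfies $\mathcal L_{v_x}\omega=0$ for all $x\in\mathfrak h$, is a family of linear maps $f_i\colon\Lambda^i\mathfrak h\to\Omega^{n-i}(M)$, $1\le i\le n$, such that, with $f_0=f_{n+1}=0$, $$-f_{i-1}(\partial q)=d f_i(q)+\varsigma(i)\,\iota(v_q)\omega\qquad(q\in\Lambda^i\mathfrak h,\ 1\le i\le n+1);$$ in particular $d(f_1(x))=-\iota_{v_x}\omega$ for $x\in\mathfrak h$, so that $f_1(x)$ is a Hamiltonian form. The co-momentum map $(f)$ of the $G$-action is *$G$-equivariant* if $\vartheta_g^*f_i(q)=f_i(\mathrm{Ad}_g q)$ for all $g\in G$, $1\le i\le n$, $q\in\Lambda^i\mathfrak g$; equivariance for a subgroup and its Lie algebra is defined in the same way. **Proposition.** Let $G$ act on a pre-$n$-plectic manifold $(M,\omega)$ as above, let $(f)$ be a co-momentum map for the infinitesimal action of $\mathfrak g$ on $(M,\omega)$, let $1\le k\le n$, and fix $p\in Z_k(\mathfrak g)$. Let $G_p=\{g\in G:\mathrm{Ad}_g p=p\}$, let $G_p^0$ be the connected component of the identity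 in $G_p$, and let $\mathfrak g_p=\{x\in\mathfrak g:[x,p]=0\}$ be its Lie algebra. Then $(M,\iota(v_p)\omega)$ is a pre-$(n-k)$-plectic manifold, $\iota(v_p)\omega$ is invariant under $G_p^0$, and the maps $$f^p_j\colon\Lambda^j\mathfrak g_p\to\Omega^{n-k-j}(M),\qquad q\mapsto-\varsigma(k)\,f_{j+k}(q\wedge p)\qquad(j=1,\dots,n-k)$$ form a co-momentum map for the (restricted) action of $G_p^0$, i.e. of $\mathfrak g_p$, on $(M,\iota(v_p)\omega)$. If moreover $(f)$ is $G$-equivariant, then $(f^p)$ is $G_p^0$-equivariant. -/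

import Mathlib

open scoped Manifold ContDiff

namespace Multisymplectic
noncomputable section

section Algebra

variable {V : Type*} [AddCommGroup V] [Module ℝ V]

/-- The extension of a linear endomorphism `φ` of `V` to a derivation of the exterior algebra. -/
def extendDerivation (φ : V →ₗ[ℝ] V) : ExteriorAlgebra ℝ V →ₗ[ℝ] ExteriorAlgebra ℝ V :=
  CliffordAlgebra.foldr' (0 : QuadraticForm ℝ V)
    (LinearMap.mk₂ ℝ (fun (x : V) (q : ExteriorAlgebra ℝ V × ExteriorAlgebra ℝ V) =>
        ExteriorAlgebra.ι ℝ (φ x) * q.1 + ExteriorAlgebra.ι ℝ x * q.2)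
      (by intros; simp only [map_add, add_mul]; abel)
      (by intros; simp only [map_smul, smul_mul_assoc, smul_add])
      (by intros; simp only [Prod.fst_add, Prod.snd_add, mul_add]; abel)
      (by intros; simp only [Prod.smul_fst, Prod.smul_snd, mul_smul_comm, smul_add]))
    (by
      intro x q r
      change ExteriorAlgebra.ι ℝ (φ x) * (ExteriorAlgebra.ι ℝ x * q) + ExteriorAlgebra.ι ℝ x *
        (ExteriorAlgebra.ι ℝ (φ x) * q + ExteriorAlgebra.ι ℝ x * r) = (0 : ℝ) • r
      rw [mul_add, ← mul_assoc, ← mul_assoc, ← mul_assoc, ExteriorAlgebra.ι_sq_zero, zero_mul,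
        add_zero, ← add_mul, ExteriorAlgebra.ι_add_mul_swap, zero_mul, zero_smul]) 0

theorem extendDerivation_one (φ : V →ₗ[ℝ] V) : extendDerivation φ 1 = 0 := by
  rw [← map_one (algebraMap ℝ (ExteriorAlgebra ℝ V))]
  exact (CliffordAlgebra.foldr'_algebraMap (0 : QuadraticForm ℝ V) _ _ _ _).trans (smul_zero _)

theorem extendDerivation_ι_mul (φ : V →ₗ[ℝ] V) (x : V) (q : ExteriorAlgebra ℝ V) :
    extendDerivation φ (ExteriorAlgebra.ι ℝ x * q) =
      ExteriorAlgebra.ι ℝ (φ x) * q + ExteriorAlgebra.ι ℝ x * extendDerivation φ q :=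
  CliffordAlgebra.foldr'_ι_mul (0 : QuadraticForm ℝ V) _ _ _ _ _

theorem ι_mul_ι_mul (x y : V) (q : ExteriorAlgebra ℝ V) :
    ExteriorAlgebra.ι ℝ x * (ExteriorAlgebra.ι ℝ y * q) =
      -(ExteriorAlgebra.ι ℝ y * (ExteriorAlgebra.ι ℝ x * q)) := by
  rw [← mul_assoc, ← mul_assoc, ← neg_mul, eq_neg_of_add_eq_zero_left
    (ExteriorAlgebra.ι_add_mul_swap x y)]

theorem extendDerivation_ιMulti (φ : V →ₗ[ℝ] V) {k : ℕ} (x : Fin (k + 1) → V) :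
    extendDerivation φ (ExteriorAlgebra.ιMulti ℝ (k + 1) x) =
      ∑ j : Fin (k + 1), (-1 : ℝ) ^ (j : ℕ) •
        (ExteriorAlgebra.ι ℝ (φ (x j)) * ExteriorAlgebra.ιMulti ℝ k (j.removeNth x)) := by
  induction k with
  | zero =>
    rw [ExteriorAlgebra.ιMulti_succ_apply, extendDerivation_ι_mul]
    simp [extendDerivation_one]
  | succ k ih =>
    rw [ExteriorAlgebra.ιMulti_succ_apply, extendDerivation_ι_mul, ih, Finset.mul_sum]
    conv_rhs => rw [Fin.sum_univ_succ]
    congr 1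
    · simp [Fin.removeNth_zero, Matrix.vecTail, Fin.tail_def, Function.comp_def]
    · refine Finset.sum_congr rfl fun j _ => ?_
      rw [ExteriorAlgebra.ιMulti_succ_apply (v := j.succ.removeNth x), mul_smul_comm, ι_mul_ι_mul]
      simp [pow_succ, Fin.removeNth, Matrix.vecTail, Function.comp_def]
      rfl

variable {L : Type*} [LieRing L] [LieAlgebra ℝ L]

/-- The bracket `[x, ·]` on the exterior algebra: the extension of `ad x` to a derivation. -/
def adExt (x : L) : ExteriorAlgebra ℝ L →ₗ[ℝ] ExteriorAlgebra ℝ L :=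
  extendDerivation (LieAlgebra.ad ℝ L x : L →ₗ[ℝ] L)


theorem adExt_ι_mul (x y : L) (q : ExteriorAlgebra ℝ L) :
    adExt x (ExteriorAlgebra.ι ℝ y * q) =
      ExteriorAlgebra.ι ℝ ⁅x, y⁆ * q + ExteriorAlgebra.ι ℝ y * adExt x q :=
  extendDerivation_ι_mul _ _ _

theorem exterior_induction {P : ExteriorAlgebra ℝ V → Prop} (h1 : P 1)
    (hadd : ∀ a b, P a → P b → P (a + b)) (hsmul : ∀ (r : ℝ) a, P a → P (r • a))
    (hmul : ∀ (x : V) a, P a → P (ExteriorAlgebra.ι ℝ x * a)) (q : ExteriorAlgebra ℝ V) : P q := by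
  refine CliffordAlgebra.left_induction (0 : QuadraticForm ℝ V) (P := P) (fun r => ?_)
    (fun a b => hadd a b) (fun a x => hmul x a) q
  rw [Algebra.algebraMap_eq_smul_one]
  exact hsmul r 1 h1

theorem adExt_add (x y : L) (q : ExteriorAlgebra ℝ L) :
    adExt (x + y) q = adExt x q + adExt y q := by
  induction q using exterior_induction with
  | h1 => simp [adExt, extendDerivation_one]
  | hadd a b ha hb => rw [map_add, map_add, map_add, ha, hb]; abel
  | hsmul r a ha => rw [map_smul, map_smul, map_smul, ha, smul_add]
  | hmul z a ha => rw [adExt_ι_mul, adExt_ι_mul, adExt_ι_mul, ha, add_lie, map_add]; noncomm_ring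

theorem adExt_smul (r : ℝ) (x : L) (q : ExteriorAlgebra ℝ L) :
    adExt (r • x) q = r • adExt x q := by
  induction q using exterior_induction with
  | h1 => simp [adExt, extendDerivation_one]
  | hadd a b ha hb => rw [map_add, map_add, ha, hb, smul_add]
  | hsmul s a ha => rw [map_smul, map_smul, ha, smul_comm]
  | hmul z a ha =>
    rw [adExt_ι_mul, adExt_ι_mul, ha, smul_lie, map_smul, smul_mul_assoc, mul_smul_comm, smul_add]

theorem adExt_lie (x y : L) (q : ExteriorAlgebra ℝ L) :
    adExt ⁅x, y⁆ q = adExt x (adExt y q) - adExt y (adExt x q) := by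
  induction q using exterior_induction with
  | h1 => simp [adExt, extendDerivation_one]
  | hadd a b ha hb => simp only [map_add, ha, hb]; abel
  | hsmul s a ha => simp only [map_smul, ha, smul_sub]
  | hmul z a ha =>
    simp only [adExt_ι_mul, map_add, ha, lie_lie, map_sub]
    noncomm_ring

/-- The Lie algebra homology differential on the whole exterior algebra; its value on
`x₀ ∧ ⋯ ∧ xₖ₊₁` is given by `boundary_ιMulti`. -/
def boundary : ExteriorAlgebra ℝ L →ₗ[ℝ] ExteriorAlgebra ℝ L :=
  CliffordAlgebra.foldr' (0 : QuadraticForm ℝ L)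
    (LinearMap.mk₂ ℝ (fun (x : L) (q : ExteriorAlgebra ℝ L × ExteriorAlgebra ℝ L) =>
        -(ExteriorAlgebra.ι ℝ x * q.2) - adExt x q.1)
      (by intros; simp only [map_add, add_mul, adExt_add]; abel)
      (by intros; simp only [map_smul, smul_mul_assoc, smul_sub, smul_neg, adExt_smul])
      (by intros; simp only [Prod.fst_add, Prod.snd_add, mul_add, map_add]; abel)
      (by intros; simp only [Prod.smul_fst, Prod.smul_snd, mul_smul_comm, map_smul, smul_sub,
        smul_neg]))
    (by
      intro x q r
      change -(ExteriorAlgebra.ι ℝ x * (-(ExteriorAlgebra.ι ℝ x * r) - adExt x q)) -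
        adExt x (ExteriorAlgebra.ι ℝ x * q) = (0 : ℝ) • r
      rw [adExt_ι_mul, lie_self, map_zero, zero_mul, zero_add, mul_sub, mul_neg, ← mul_assoc,
        ExteriorAlgebra.ι_sq_zero, zero_mul, zero_smul]
      abel) 0

theorem boundary_one : boundary (1 : ExteriorAlgebra ℝ L) = 0 := by
  rw [← map_one (algebraMap ℝ (ExteriorAlgebra ℝ L))]
  exact (CliffordAlgebra.foldr'_algebraMap (0 : QuadraticForm ℝ L) _ _ _ _).trans (smul_zero _)

theorem boundary_ι_mul (x : L) (q : ExteriorAlgebra ℝ L) :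
    boundary (ExteriorAlgebra.ι ℝ x * q) =
      -(ExteriorAlgebra.ι ℝ x * boundary q) - adExt x q :=
  CliffordAlgebra.foldr'_ι_mul (0 : QuadraticForm ℝ L) _ _ _ _ _

theorem boundary_ιMulti {k : ℕ} (x : Fin (k + 2) → L) :
    boundary (ExteriorAlgebra.ιMulti ℝ (k + 2) x) =
      ∑ j : Fin (k + 2), ∑ i : Fin (k + 1), if i.castSucc < j then
        (-1 : ℝ) ^ ((i : ℕ) + (j : ℕ)) • (ExteriorAlgebra.ι ℝ ⁅x i.castSucc, x j⁆ *
          ExteriorAlgebra.ιMulti ℝ k (i.removeNth (j.removeNth x))) else 0 := by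
  induction k with
  | zero =>
    rw [ExteriorAlgebra.ιMulti_succ_apply, boundary_ι_mul, ExteriorAlgebra.ιMulti_succ_apply,
      boundary_ι_mul, adExt_ι_mul]
    simp [boundary_one, adExt, extendDerivation_one, Fin.sum_univ_succ, Matrix.vecTail]
  | succ k ih =>
    rw [ExteriorAlgebra.ιMulti_succ_apply, boundary_ι_mul, ih, adExt, extendDerivation_ιMulti]
    conv_rhs => rw [Fin.sum_univ_succ]
    simp only [Fin.not_lt_zero, if_false, Finset.sum_const_zero, zero_add]
    rw [sub_eq_add_neg, add_comm, Finset.mul_sum, ← Finset.sum_neg_distrib,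
      ← Finset.sum_neg_distrib, ← Finset.sum_add_distrib]
    refine Finset.sum_congr rfl fun j _ => ?_
    rw [Fin.sum_univ_succ (n := k + 1)]
    congr 1
    · simp [pow_succ, Fin.removeNth_zero, Fin.tail_def, Fin.removeNth, Matrix.vecTail,
        Function.comp_def]
    · rw [Finset.mul_sum, ← Finset.sum_neg_distrib]
      refine Finset.sum_congr rfl fun i _ => ?_
      by_cases h : i.castSucc < j
      · rw [if_pos h, if_pos (by simpa using h),
          ExteriorAlgebra.ιMulti_succ_apply (v := i.succ.removeNth (j.succ.removeNth x)),
          mul_smul_comm, ι_mul_ι_mul]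
        simp [Fin.removeNth, Matrix.vecTail, Function.comp_def]
        rw [show (i : ℕ) + 1 + ((j : ℕ) + 1) = (i + j) + 2 by ring, pow_add _ _ 2, neg_one_sq,
          mul_one]
        rfl
      · rw [if_neg h, if_neg (by simpa using h)]; simp

theorem boundary_mem {k : ℕ} {p : ExteriorAlgebra ℝ L} (hp : p ∈ ⋀[ℝ]^(k + 1) L) :
    boundary p ∈ ⋀[ℝ]^k L := by
  rw [← ExteriorAlgebra.ιMulti_span_fixedDegree] at hp
  induction hp using Submodule.span_induction with
  | zero => rw [map_zero]; exact Submodule.zero_mem _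
  | add a b _ _ ha hb => rw [map_add]; exact Submodule.add_mem _ ha hb
  | smul r a _ ha => rw [map_smul]; exact Submodule.smul_mem _ _ ha
  | mem a ha =>
    obtain ⟨x, rfl⟩ := ha
    cases k with
    | zero =>
      rw [ExteriorAlgebra.ιMulti_succ_apply, boundary_ι_mul]
      simp [boundary_one, adExt, extendDerivation_one]
    | succ k =>
      rw [boundary_ιMulti]
      refine Submodule.sum_mem _ fun j _ => Submodule.sum_mem _ fun i _ => ?_
      split_ifs
      · refine Submodule.smul_mem _ _ ?_
        have h := ExteriorAlgebra.ιMulti_range ℝ (k + 1) (M := L)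
          ⟨Matrix.vecCons ⁅x i.castSucc, x j⁆ (i.removeNth (j.removeNth x)), rfl⟩
        rw [ExteriorAlgebra.ιMulti_succ_apply] at h
        exact h
      · exact Submodule.zero_mem _

/-- The Lie algebra homology differential `∂ : Λᵏ⁺¹ L → Λᵏ L`. -/
def boundaryAt (k : ℕ) : ⋀[ℝ]^(k + 1) L →ₗ[ℝ] ⋀[ℝ]^k L :=
  (boundary.domRestrict (⋀[ℝ]^(k + 1) L)).codRestrict (⋀[ℝ]^k L) fun p => boundary_mem p.2

/-- The map `q ↦ q ∧ p`, from `Λʲ V` to `Λʲ⁺ᵏ V`. -/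
def wedgeRight (j : ℕ) {k : ℕ} (p : ⋀[ℝ]^k V) : ⋀[ℝ]^j V →ₗ[ℝ] ⋀[ℝ]^(j + k) V :=
  ((LinearMap.mulRight ℝ (p : ExteriorAlgebra ℝ V)).domRestrict (⋀[ℝ]^j V)).codRestrict
    (⋀[ℝ]^(j + k) V) fun q => SetLike.mul_mem_graded q.2 p.2

/-- The sign `ς(k) = -(-1)^{k(k+1)/2}`. -/
def varsigma (k : ℕ) : ℝ := -(-1) ^ (k * (k + 1) / 2)

/-- The isotropy Lie algebra `{x | [x, p] = 0}` of `p ∈ Λᵏ L`. -/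
def isotropyAlgebra {k : ℕ} (p : ⋀[ℝ]^k L) : LieSubalgebra ℝ L where
  carrier := {x | adExt x (p : ExteriorAlgebra ℝ L) = 0}
  zero_mem' := by
    change adExt 0 _ = 0
    have h := adExt_smul (0 : ℝ) (0 : L) (p : ExteriorAlgebra ℝ L)
    rwa [zero_smul, zero_smul] at h
  add_mem' {x y} hx hy := by
    change adExt x _ = 0 at hx
    change adExt y _ = 0 at hy
    change adExt (x + y) _ = 0
    rw [adExt_add, hx, hy, add_zero]
  smul_mem' r x hx := by
    change adExt x _ = 0 at hx
    change adExt (r • x) _ = 0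
    rw [adExt_smul, hx, smul_zero]
  lie_mem' {x y} hx hy := by
    change adExt x _ = 0 at hx
    change adExt y _ = 0 at hy
    change adExt ⁅x, y⁆ _ = 0
    rw [adExt_lie, hx, hy, map_zero, map_zero, sub_zero]

theorem mem_isotropyAlgebra {k : ℕ} (p : ⋀[ℝ]^k L) (x : L) :
    x ∈ isotropyAlgebra p ↔ adExt x (p : ExteriorAlgebra ℝ L) = 0 := Iff.rfl

theorem adExt_map {L' : Type*} [LieRing L'] [LieAlgebra ℝ L'] (A : L →ₗ[ℝ] L')
    (hA : ∀ x y, A ⁅x, y⁆ = ⁅A x, A y⁆) (x : L) (q : ExteriorAlgebra ℝ L) :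
    adExt (A x) (ExteriorAlgebra.map A q) = ExteriorAlgebra.map A (adExt x q) := by
  induction q using exterior_induction with
  | h1 => simp [adExt, extendDerivation_one]
  | hadd a b ha hb => simp only [map_add, ha, hb]
  | hsmul s a ha => simp only [map_smul, ha]
  | hmul z a ha =>
    rw [map_mul, ExteriorAlgebra.map_apply_ι, adExt_ι_mul, ha, adExt_ι_mul, map_add, map_mul,
      map_mul, ExteriorAlgebra.map_apply_ι, ExteriorAlgebra.map_apply_ι, hA]

theorem coe_exteriorPower_map {W : Type*} [AddCommGroup W] [Module ℝ W] (k : ℕ) (A : V →ₗ[ℝ] W)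
    (q : ⋀[ℝ]^k V) : (exteriorPower.map k A q : ExteriorAlgebra ℝ W) =
      ExteriorAlgebra.map A (q : ExteriorAlgebra ℝ V) := by
  suffices h : (⋀[ℝ]^k W).subtype ∘ₗ exteriorPower.map k A =
      (ExteriorAlgebra.map A).toLinearMap ∘ₗ (⋀[ℝ]^k V).subtype from LinearMap.congr_fun h q
  refine exteriorPower.linearMap_ext ?_
  ext x
  simp [ExteriorAlgebra.map_apply_ιMulti]

theorem append_update_right {α : Type*} {k e : ℕ} [DecidableEq (Fin e)] 
    (x : Fin k → α) (w : Fin e → α) (i : Fin e) (a : α) :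
    Fin.append x (Function.update w i a) =
      Function.update (Fin.append x w) (Fin.natAdd k i) a := by
  ext j
  refine Fin.addCases (fun j => ?_) (fun j => ?_) j
  · rw [Fin.append_left, Function.update_of_ne, Fin.append_left]
    exact fun h => by have := congrArg Fin.val h; simp at this; omega
  · rw [Fin.append_right]
    by_cases h : j = i
    · subst h; simp
    · rw [Function.update_of_ne h, Function.update_of_ne, Fin.append_right]
      simpa using h

theorem append_update_left {α : Type*} {k e : ℕ} [DecidableEq (Fin k)] 
    (x : Fin k → α) (w : Fin e → α) (i : Fin k) (a : α) :
    Fin.append (Function.update x i a) w =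
      Function.update (Fin.append x w) (Fin.castAdd e i) a := by
  ext j
  refine Fin.addCases (fun j => ?_) (fun j => ?_) j
  · rw [Fin.append_left]
    by_cases h : j = i
    · subst h; simp
    · rw [Function.update_of_ne h, Function.update_of_ne, Fin.append_left]
      simpa using h
  · rw [Fin.append_right, Function.update_of_ne, Fin.append_right]
    exact fun h => by have := congrArg Fin.val h; simp at this; omega

section Contraction

variable [TopologicalSpace V] {N k e : ℕ}

/-- The form `η(x₁, …, xₖ, ·, …, ·)`. -/
def contractTuple (h : k + e = N) (η : V [⋀^Fin N]→L[ℝ] ℝ) (x : Fin k → V) :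
    V [⋀^Fin e]→L[ℝ] ℝ where
  toFun w := η (Fin.append x w ∘ Fin.cast h.symm)
  map_update_add' w i a b := by
    subst h
    simp only [append_update_right, Fin.cast_refl, Function.comp_id]
    exact η.map_update_add _ _ _ _
  map_update_smul' w i c a := by
    subst h
    simp only [append_update_right, Fin.cast_refl, Function.comp_id]
    exact η.map_update_smul _ _ _ _
  map_eq_zero_of_eq' w i j hw hij := by
    subst h
    refine η.map_eq_zero_of_eq _ (i := Fin.natAdd k i) (j := Fin.natAdd k j) ?_ (by simpa using hij)
    simpa using hw
  cont := by
    subst h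
    refine η.cont.comp (continuous_pi fun j => ?_)
    refine Fin.addCases (fun j => ?_) (fun j => ?_) j
    · simpa using continuous_const
    · simpa using continuous_apply j

/-- The contraction `ι(P) η` of a form `η` on `V` with `P ∈ Λᵏ V`. It is linear in `P`, and
`ι(x₁ ∧ ⋯ ∧ xₖ) η = ι(xₖ) ⋯ ι(x₁) η = η(x₁, …, xₖ, ·, …, ·)`. -/
def contractMulti (h : k + e = N) (η : V [⋀^Fin N]→L[ℝ] ℝ) :
    ⋀[ℝ]^k V →ₗ[ℝ] V [⋀^Fin e]→L[ℝ] ℝ :=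
  exteriorPower.alternatingMapLinearEquiv
    { toFun := contractTuple h η
      map_update_add' := by
        intro _ x i a b
        subst h
        ext w
        simp only [contractTuple, append_update_left, Fin.cast_refl, Function.comp_id]
        exact η.map_update_add _ _ _ _
      map_update_smul' := by
        intro _ x i c a
        subst h
        ext w
        simp only [contractTuple, append_update_left, Fin.cast_refl, Function.comp_id]
        exact η.map_update_smul _ _ _ _
      map_eq_zero_of_eq' := by
        intro x i j hx hij
        subst h
        ext w
        refine η.map_eq_zero_of_eq _ (i := Fin.castAdd e i) (j := Fin.castAdd e j) ?_
          (by simpa using hij)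
        simpa using hx }

theorem contractMulti_ιMulti (h : k + e = N) (η : V [⋀^Fin N]→L[ℝ] ℝ) (x : Fin k → V)
    (w : Fin e → V) :
    contractMulti h η (exteriorPower.ιMulti ℝ k x) w = η (Fin.append x w ∘ Fin.cast h.symm) := by
  rw [contractMulti, exteriorPower.alternatingMapLinearEquiv_apply_ιMulti]
  rfl

end Contraction

end Algebra

section Forms

variable (E : Type*) [NormedAddCommGroup E] [NormedSpace ℝ E]
  (M : Type*) [TopologicalSpace M] [ChartedSpace E M] [IsManifold 𝓘(ℝ, E) ∞ M]

/-- Not necessarily smooth differential forms of degree `d` on `M`. -/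
abbrev Form (d : ℕ) : Type _ := ∀ m : M, TangentSpace 𝓘(ℝ, E) m [⋀^Fin d]→L[ℝ] ℝ

/-- Not necessarily smooth vector fields on `M`. -/
abbrev VField : Type _ := ∀ m : M, TangentSpace 𝓘(ℝ, E) m

variable {E M}

/-- The pullback `φ^* α` of a form. -/
def pullback {d : ℕ} (φ : M → M) (α : Form E M d) : Form E M d :=
  fun m => (α (φ m)).compContinuousLinearMap (mfderiv 𝓘(ℝ, E) 𝓘(ℝ, E) φ m)

/-- The expression of a form in the chart at `m₀`, i.e. its pullback under the inverse of
this chart. It is meaningful on the target of the chart. -/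
def inChart {d : ℕ} (α : Form E M d) (m₀ : M) : E → E [⋀^Fin d]→L[ℝ] ℝ :=
  fun y => (α ((extChartAt 𝓘(ℝ, E) m₀).symm y)).compContinuousLinearMap
    (mfderiv 𝓘(ℝ, E) 𝓘(ℝ, E) (extChartAt 𝓘(ℝ, E) m₀).symm y)

/-- A form is smooth if its expressions in the charts are. -/
def IsSmoothForm {d : ℕ} (α : Form E M d) : Prop :=
  ∀ m₀ : M, ContDiffOn ℝ ∞ (inChart α m₀) (extChartAt 𝓘(ℝ, E) m₀).target

variable (E M) in
/-- The space `Ω^d(M)` of smooth differential forms. -/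
def smoothForms (d : ℕ) : Submodule ℝ (Form E M d) where
  carrier := {α | IsSmoothForm α}
  zero_mem' := fun _ => contDiffOn_const (c := 0)
  add_mem' ha hb := fun m₀ => (ha m₀).add (hb m₀)
  smul_mem' c _ ha := fun m₀ => (ha m₀).const_smul c

/-- The exterior derivative: at `m`, it is computed in the chart at `m`. -/
def extD {d : ℕ} (α : Form E M d) : Form E M (d + 1) :=
  fun m => (extDeriv (inChart α m) (extChartAt 𝓘(ℝ, E) m m)).compContinuousLinearMap
    (mfderiv 𝓘(ℝ, E) 𝓘(ℝ, E) (extChartAt 𝓘(ℝ, E) m) m)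

/-- The contraction of a form with a multivector field. -/
def contract {N k e : ℕ} (h : k + e = N) (P : ∀ m : M, ⋀[ℝ]^k (TangentSpace 𝓘(ℝ, E) m))
    (α : Form E M N) : Form E M e :=
  fun m => contractMulti h (α m) (P m)

/-- The contraction `ι_X α` of a form with a vector field. -/
def interior {N e : ℕ} (h : 1 + e = N) (X : VField E M) (α : Form E M N) : Form E M e :=
  contract h (fun m => exteriorPower.ιMulti ℝ 1 fun _ => X m) α

/-- The Lie derivative `L_X α = d ι_X α + ι_X d α`. -/
def lieDerivative {e : ℕ} (X : VField E M) (α : Form E M (e + 1)) : Form E M (e + 1) :=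
  extD (interior (Nat.add_comm 1 e) X α) + interior (Nat.add_comm 1 (e + 1)) X (extD α)

/-- Smoothness of a vector field, as a section of the tangent bundle. -/
def IsSmoothVField (X : VField E M) : Prop :=
  ContMDiff 𝓘(ℝ, E) (𝓘(ℝ, E).prod 𝓘(ℝ, E)) ∞ (fun m => (⟨m, X m⟩ : TangentBundle 𝓘(ℝ, E) M))

/-- `(M, η)` is a pre-`n`-plectic manifold: `η` is a smooth closed form of degree `n + 1`. -/
structure IsPrePlectic (n : ℕ) (η : Form E M (n + 1)) : Prop where
  smooth : η ∈ smoothForms E M (n + 1)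
  closed : extD η = 0

/-- `α`, of degree `d = n - 1`, is a Hamiltonian form on `(M, η)`. -/
def IsHamiltonian {n d : ℕ} (h : 1 + d = n) (η : Form E M (n + 1)) (α : Form E M d) : Prop :=
  ∃ X : VField E M, IsSmoothVField X ∧ extD α = -interior (by omega) X η

variable {L : Type*} [LieRing L] [LieAlgebra ℝ L]

/-- The multivector field `v_p`, where `v_{x₁ ∧ ⋯ ∧ xₖ} = v_{x₁} ∧ ⋯ ∧ v_{xₖ}`. -/
def multiField (v : ∀ m : M, L →ₗ[ℝ] TangentSpace 𝓘(ℝ, E) m) {k : ℕ} (p : ⋀[ℝ]^k L) (m : M) :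
    ⋀[ℝ]^k (TangentSpace 𝓘(ℝ, E) m) :=
  exteriorPower.map k (v m) p

/-- `x ↦ v_x` is a multisymplectic infinitesimal action of the Lie algebra `L` on `(M, η)`:
a Lie algebra homomorphism to the smooth vector fields on `M` that preserve `η`. -/
structure IsMultisymplecticAction {n : ℕ} (v : ∀ m : M, L →ₗ[ℝ] TangentSpace 𝓘(ℝ, E) m)
    (η : Form E M (n + 1)) : Prop where
  smooth : ∀ x, IsSmoothVField fun m => v m x
  map_lie : ∀ x y m, v m ⁅x, y⁆ =
    VectorField.mlieBracket 𝓘(ℝ, E) (fun m => v m x) (fun m => v m y) m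
  lieDerivative_eq_zero : ∀ x, lieDerivative (fun m => v m x) η = 0

variable (E M L) in
/-- Families of linear maps `f_i : Λ^i L → Ω^d(M)`, where `d = n - i`. -/
abbrev Components (n : ℕ) : Type _ :=
  ∀ i d : ℕ, i + d = n → (⋀[ℝ]^i L →ₗ[ℝ] smoothForms E M d)

/-- `f` is an `L_∞`-morphism from `L` to the observables of `(M, η)`: the image of `f_1` consists
of Hamiltonian forms, and `-f_{k-1}(∂q) = d f_k(q) + ς(k) ι(v_q) η` for `q ∈ Λᵏ L` and
`1 ≤ k ≤ n + 1`, where `f_0 = 0` and `f_{n+1} = 0`. The field `main` is the case `k = i + 1 ≤ n`,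
the field `top` the case `k = n + 1`. -/
structure IsLInftyMorphism {n : ℕ} (v : ∀ m : M, L →ₗ[ℝ] TangentSpace 𝓘(ℝ, E) m)
    (η : Form E M (n + 1)) (f : Components E M L n) : Prop where
  zero : ∀ d h, f 0 d h = 0
  hamiltonian : ∀ d (h : 1 + d = n) q, IsHamiltonian h η (f 1 d h q)
  main : ∀ i d (h : i + 1 + d = n) (q : ⋀[ℝ]^(i + 1) L),
    -(f i (d + 1) (by omega) (boundaryAt i q) : Form E M (d + 1)) =
      extD (f (i + 1) d h q : Form E M d) +
        varsigma (i + 1) • contract (by omega) (multiField v q) η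
  top : ∀ q : ⋀[ℝ]^(n + 1) L,
    -(f n 0 rfl (boundaryAt n q) : Form E M 0) =
      varsigma (n + 1) • contract rfl (multiField v q) η

/-- `f` is a homotopy co-momentum map for the infinitesimal action `v` on `(M, η)`. -/
structure IsCoMomentumMap {n : ℕ} (v : ∀ m : M, L →ₗ[ℝ] TangentSpace 𝓘(ℝ, E) m)
    (η : Form E M (n + 1)) (f : Components E M L n) : Prop where
  action : IsMultisymplecticAction v η
  morphism : IsLInftyMorphism v η f
  momentum : ∀ d (h : 1 + d = n) (x : L),
    extD (f 1 d h (exteriorPower.ιMulti ℝ 1 fun _ => x) : Form E M d) =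
      -interior (by omega) (fun m => v m x) η

/-- Equivariance of the components `f_i`, `1 ≤ i ≤ n`: `ρ_g^* (f_i q) = f_i (A_g q)`. -/
def IsEquivariant {K : Type*} {n : ℕ} (ρ : K → M → M) (A : K → L →ₗ[ℝ] L)
    (f : Components E M L n) : Prop :=
  ∀ g i d (h : i + d = n), 1 ≤ i → ∀ q : ⋀[ℝ]^i L,
    pullback (ρ g) (f i d h q : Form E M d) = f i d h (exteriorPower.map i (A g) q)

/-- `f^p_j(q) = -ς(k) f_{j+k}(q ∧ p)` for `j ≥ 1`, as maps on `Λ^j` of the isotropy algebra. -/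
def inducedComponents {n k r : ℕ} (hkr : k + r = n) (p : ⋀[ℝ]^k L) (f : Components E M L n) :
    Components E M (isotropyAlgebra p) r
  | 0, _, _ => 0
  | j + 1, d, h => -varsigma k • (f (j + 1 + k) d (by omega) ∘ₗ wedgeRight (j + 1) p ∘ₗ
      exteriorPower.map (j + 1) (isotropyAlgebra p).toSubmodule.subtype)

end Forms

section Group

variable {F : Type*} [NormedAddCommGroup F] [NormedSpace ℝ F] [CompleteSpace F]
  {G : Type*} [TopologicalSpace G] [ChartedSpace F G] [Group G]
  [LieGroup 𝓘(ℝ, F) ∞ G]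

instance lieGroup_minSmoothness : LieGroup 𝓘(ℝ, F) (minSmoothness ℝ 3) G := by
  rw [minSmoothness_of_isRCLikeNormedField]
  infer_instance

variable (F) in
/-- The adjoint action of `g`: the differential at `1` of `h ↦ g h g⁻¹`. -/
def Ad (g : G) : GroupLieAlgebra 𝓘(ℝ, F) G →ₗ[ℝ] GroupLieAlgebra 𝓘(ℝ, F) G :=
  (show F →L[ℝ] F from mfderiv 𝓘(ℝ, F) 𝓘(ℝ, F) (fun h : G => g * h * g⁻¹) 1).toLinearMap

theorem contMDiff_conj (g : G) :
    ContMDiff 𝓘(ℝ, F) 𝓘(ℝ, F) ∞ (fun h : G => g * h * g⁻¹) :=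
  (contMDiff_const.mul contMDiff_id).mul contMDiff_const

theorem mdifferentiableAt_conj (g h : G) :
    MDifferentiableAt 𝓘(ℝ, F) 𝓘(ℝ, F) (fun h : G => g * h * g⁻¹) h :=
  (contMDiff_conj g).mdifferentiable (by simp) h

theorem mdifferentiableAt_mulLeft (g h : G) :
    MDifferentiableAt 𝓘(ℝ, F) 𝓘(ℝ, F) (fun h : G => g * h) h :=
  (contMDiff_mul_left (n := ∞)).mdifferentiable (by simp) h

variable (F) in
/-- The differential of a map of `G` to itself, as an endomorphism of the model space, to which
all tangent spaces are equal by definition. -/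
def diffAt (φ : G → G) (g : G) : F →L[ℝ] F := mfderiv 𝓘(ℝ, F) 𝓘(ℝ, F) φ g

theorem diffAt_id (g : G) : diffAt F (id : G → G) g = ContinuousLinearMap.id ℝ F :=
  mfderiv_id

theorem diffAt_comp {φ ψ : G → G} (g : G) (hψ : MDifferentiableAt 𝓘(ℝ, F) 𝓘(ℝ, F) ψ (φ g))
    (hφ : MDifferentiableAt 𝓘(ℝ, F) 𝓘(ℝ, F) φ g) :
    diffAt F (fun x => ψ (φ x)) g = (diffAt F ψ (φ g)).comp (diffAt F φ g) :=
  mfderiv_comp (I' := 𝓘(ℝ, F)) g hψ hφ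

theorem Ad_apply (g : G) (x : GroupLieAlgebra 𝓘(ℝ, F) G) :
    Ad F g x = diffAt F (fun h : G => g * h * g⁻¹) 1 x := rfl

theorem Ad_one : Ad F (1 : G) = LinearMap.id := by
  have h : (fun h : G => (1 : G) * h * (1 : G)⁻¹) = id := by ext h; simp
  ext x
  rw [Ad_apply, h, diffAt_id]
  rfl

theorem diffAt_conj_comp (g h x : G) : diffAt F (fun x : G => g * h * x * (g * h)⁻¹) x =
    (diffAt F (fun x : G => g * x * g⁻¹) (h * x * h⁻¹)).comp
      (diffAt F (fun x : G => h * x * h⁻¹) x) := by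
  rw [← diffAt_comp x (mdifferentiableAt_conj _ _) (mdifferentiableAt_conj _ _)]
  congr 1
  ext x; simp [mul_assoc]

theorem Ad_mul (g h : G) : Ad F (g * h) = Ad F g ∘ₗ Ad F h := by
  ext x
  rw [Ad_apply, diffAt_conj_comp, mul_one, mul_inv_cancel]
  rfl

theorem diffAt_conj_inverse (g h : G) :
    (diffAt F (fun x : G => g * x * g⁻¹) h).inverse =
      diffAt F (fun x : G => g⁻¹ * x * g⁻¹⁻¹) (g * h * g⁻¹) := by
  have e : (fun h : G => (1 : G) * h * (1 : G)⁻¹) = id := by ext h; simp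
  have e3 : g⁻¹ * (g * h * g⁻¹) * g⁻¹⁻¹ = h := by simp [mul_assoc]
  have d1 := diffAt_conj_comp (F := F) g⁻¹ g h
  have d2 := diffAt_conj_comp (F := F) g g⁻¹ (g * h * g⁻¹)
  rw [inv_mul_cancel, e, diffAt_id] at d1
  rw [mul_inv_cancel, e, diffAt_id, e3] at d2
  exact ContinuousLinearMap.inverse_eq d2.symm d1.symm

theorem mpullback_conj (g : G) (x : GroupLieAlgebra 𝓘(ℝ, F) G) :
    VectorField.mpullback 𝓘(ℝ, F) 𝓘(ℝ, F) (fun h : G => g * h * g⁻¹)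
      (mulInvariantVectorField (Ad F g x)) = mulInvariantVectorField x := by
  ext h
  change (diffAt F (fun x : G => g * x * g⁻¹) h).inverse
    (diffAt F (fun y : G => g * h * g⁻¹ * y) 1 (diffAt F (fun h : G => g * h * g⁻¹) 1 x)) =
      diffAt F (fun y : G => h * y) 1 x
  have e1 : g * (1 : G) * g⁻¹ = 1 := by simp
  have d1 := diffAt_comp (F := F) (1 : G) (mdifferentiableAt_mulLeft (g * h * g⁻¹) (g * 1 * g⁻¹))
    (mdifferentiableAt_conj g 1)
  have d2 := diffAt_comp (F := F) (1 : G) (mdifferentiableAt_conj g (h * 1))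
    (mdifferentiableAt_mulLeft h 1)
  have e2 : (fun x : G => g * h * g⁻¹ * (g * x * g⁻¹)) = fun x => g * (h * x) * g⁻¹ := by
    ext x; simp [mul_assoc]
  rw [e1] at d1
  rw [mul_one] at d2
  rw [e2, d2] at d1
  have d3 := diffAt_conj_comp (F := F) g⁻¹ g h
  have e : (fun h : G => (1 : G) * h * (1 : G)⁻¹) = id := by ext h; simp
  rw [inv_mul_cancel, e, diffAt_id] at d3
  rw [diffAt_conj_inverse]
  exact (congrArg (diffAt F (fun x : G => g⁻¹ * x * g⁻¹⁻¹) (g * h * g⁻¹))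
    (DFunLike.congr_fun d1 (x : F)).symm).trans
      (DFunLike.congr_fun d3 (diffAt F (fun y : G => h * y) 1 (x : F))).symm

theorem Ad_lie (g : G) (x y : GroupLieAlgebra 𝓘(ℝ, F) G) :
    Ad F g ⁅x, y⁆ = ⁅Ad F g x, Ad F g y⁆ := by
  have e1 : g * (1 : G) * g⁻¹ = 1 := by simp
  have key : ∀ (Z : ∀ h : G, TangentSpace 𝓘(ℝ, F) h), (VectorField.mpullback 𝓘(ℝ, F) 𝓘(ℝ, F)
      (fun h : G => g * h * g⁻¹) Z (1 : G) : F) = Ad F g⁻¹ (Z 1) := by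
    intro Z
    have h1 : (VectorField.mpullback 𝓘(ℝ, F) 𝓘(ℝ, F) (fun h : G => g * h * g⁻¹) Z (1 : G) : F) =
      (diffAt F (fun x : G => g * x * g⁻¹) 1).inverse (Z (g * 1 * g⁻¹) : F) := rfl
    rw [h1, diffAt_conj_inverse, e1]
    rfl
  have h : ⁅x, y⁆ = Ad F g⁻¹ ⁅Ad F g x, Ad F g y⁆ := by
    rw [GroupLieAlgebra.bracket_def, GroupLieAlgebra.bracket_def, ← key,
      VectorField.mpullback_mlieBracket (n := ∞)
        (mdifferentiableAt_mulInvariantVectorField _) (mdifferentiableAt_mulInvariantVectorField _)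
        (contMDiff_conj g 1) (by rw [minSmoothness_of_isRCLikeNormedField]; exact ENat.LEInfty.out),
      mpullback_conj, mpullback_conj]
  rw [h, ← LinearMap.comp_apply, ← Ad_mul, mul_inv_cancel, Ad_one, LinearMap.id_apply]

/-- The isotropy group `G_p` for the adjoint action of `G` on `Λᵏ 𝔤`. -/
def isotropyGroup {k : ℕ} (p : ⋀[ℝ]^k (GroupLieAlgebra 𝓘(ℝ, F) G)) : Subgroup G where
  carrier := {g | exteriorPower.map k (Ad F g) p = p}
  one_mem' := by
    change exteriorPower.map k (Ad F 1) p = p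
    rw [Ad_one, exteriorPower.map_id, LinearMap.id_apply]
  mul_mem' {g h} hg hh := by
    change exteriorPower.map k (Ad F g) p = p at hg
    change exteriorPower.map k (Ad F h) p = p at hh
    change exteriorPower.map k (Ad F (g * h)) p = p
    rw [Ad_mul, exteriorPower.map_comp, LinearMap.comp_apply, hh, hg]
  inv_mem' {g} hg := by
    change exteriorPower.map k (Ad F g) p = p at hg
    change exteriorPower.map k (Ad F g⁻¹) p = p
    conv_lhs => rw [← hg]
    rw [← LinearMap.comp_apply, ← exteriorPower.map_comp, ← Ad_mul, inv_mul_cancel, Ad_one,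
      exteriorPower.map_id, LinearMap.id_apply]

/-- The connected component `G_p^0` of the identity in `G_p`, as a subgroup of `G`. -/
def isotropyComponent {k : ℕ} (p : ⋀[ℝ]^k (GroupLieAlgebra 𝓘(ℝ, F) G)) : Subgroup G :=
  haveI : IsTopologicalGroup G := topologicalGroup_of_lieGroup 𝓘(ℝ, F) ∞
  (Subgroup.connectedComponentOfOne (isotropyGroup p)).map (isotropyGroup p).subtype

theorem isotropyComponent_le {k : ℕ} (p : ⋀[ℝ]^k (GroupLieAlgebra 𝓘(ℝ, F) G)) :
    isotropyComponent p ≤ isotropyGroup p := by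
  rintro _ ⟨g, _, rfl⟩
  exact g.2

theorem Ad_mem_isotropyAlgebra {k : ℕ} (p : ⋀[ℝ]^k (GroupLieAlgebra 𝓘(ℝ, F) G)) {g : G}
    (hg : g ∈ isotropyGroup p) {x : GroupLieAlgebra 𝓘(ℝ, F) G} (hx : x ∈ isotropyAlgebra p) :
    Ad F g x ∈ isotropyAlgebra p := by
  rw [mem_isotropyAlgebra] at hx ⊢
  have hg' : exteriorPower.map k (Ad F g) p = p := hg
  have h := congrArg (fun q : ⋀[ℝ]^k (GroupLieAlgebra 𝓘(ℝ, F) G) =>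
    (q : ExteriorAlgebra ℝ (GroupLieAlgebra 𝓘(ℝ, F) G))) hg'
  simp only [coe_exteriorPower_map] at h
  rw [← h, adExt_map _ (Ad_lie g), hx, map_zero]

/-- The adjoint action of `G_p^0` on the isotropy algebra `𝔤_p`. -/
def isotropyAd {k : ℕ} (p : ⋀[ℝ]^k (GroupLieAlgebra 𝓘(ℝ, F) G)) (g : isotropyComponent p) :
    isotropyAlgebra p →ₗ[ℝ] isotropyAlgebra p :=
  (Ad F (g : G)).restrict (p := (isotropyAlgebra p).toSubmodule)
    (q := (isotropyAlgebra p).toSubmodule)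
    fun _ hx => Ad_mem_isotropyAlgebra p (isotropyComponent_le p g.2) hx

variable {E : Type*} [NormedAddCommGroup E] [NormedSpace ℝ E]
  {M : Type*} [TopologicalSpace M] [ChartedSpace E M] [IsManifold 𝓘(ℝ, E) ∞ M]

variable (F E G M) in
/-- A smooth right action of the Lie group `G` on the manifold `M`. -/
structure SmoothRightAction where
  act : M → G → M
  act_one : ∀ m, act m 1 = m
  act_mul : ∀ m g h, act m (g * h) = act (act m g) h
  smooth : ContMDiff (𝓘(ℝ, E).prod 𝓘(ℝ, F)) 𝓘(ℝ, E) ∞ (fun q : M × G => act q.1 q.2)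

/-- The infinitesimal action `v_x(m) = d/dt|₀ m·exp(tx)`, i.e. the image of `x` under the
differential at `1` of `g ↦ m·g`. -/
def SmoothRightAction.infinitesimal (ϑ : SmoothRightAction F G E M) (m : M) :
    GroupLieAlgebra 𝓘(ℝ, F) G →ₗ[ℝ] TangentSpace 𝓘(ℝ, E) m :=
  (show F →L[ℝ] E from mfderiv 𝓘(ℝ, F) 𝓘(ℝ, E) (fun g : G => ϑ.act m g) 1).toLinearMap

/-- The restriction of an infinitesimal action to a Lie subalgebra. -/
def restrictAction {L : Type*} [LieRing L] [LieAlgebra ℝ L] (S : LieSubalgebra ℝ L)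
    (v : ∀ m : M, L →ₗ[ℝ] TangentSpace 𝓘(ℝ, E) m) (m : M) : S →ₗ[ℝ] TangentSpace 𝓘(ℝ, E) m :=
  v m ∘ₗ S.toSubmodule.subtype

end Group
end
end Multisymplectic

/-!
Let `p` be a cycle in `Λᵏ 𝔤`. The equation satisfied by `f_k(p)` says that `ι(v_p) η` is exact, or
that it vanishes if `k = n + 1`; in particular it is closed. If `x ∈ 𝔤_p`, then `x ∧ p` is again a
cycle, so that `ι(v_x) ι(v_p) η` is closed as well and `𝔤_p` preserves `ι(v_p) η`. For
`q ∈ Λʲ 𝔤_p` one has `∂(q ∧ p) = ∂q ∧ p`, since all brackets between `q` and `p` vanish. The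
equation for `f_{j+k}(q ∧ p)` thus becomes the one for `f^p_j(q)`, up to signs that cancel
because of `ς(k) ς(j + k) = -(-1)^{jk} ς(j)`.

By Cartan's formula, `g ↦ (ϑ_g^* η)_m(w)` has derivative zero at `1` for all `m` and `w`, hence, by
the action property, at every `g`. It is therefore constant on connected subsets of `G`, and
`ϑ_g^*` preserves `η` for `g ∈ G_p^0`. As `ϑ_g^*(ι(v_p) η) = ι(v_{Ad_g p}) ϑ_g^* η`, it also
preserves `ι(v_p) η`.
-/

namespace Multisymplectic
noncomputable section

/-! ### Exterior algebra -/

section GradedCommutativity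

variable {R : Type*} [CommRing R] {V : Type*} [AddCommGroup V] [Module R V]

theorem exteriorPower_induction {k : ℕ} {P : ⋀[R]^k V → Prop} (zero : P 0)
    (add : ∀ a b, P a → P b → P (a + b)) (smul : ∀ (r : R) a, P a → P (r • a))
    (ιMulti : ∀ x, P (exteriorPower.ιMulti R k x)) (q : ⋀[R]^k V) : P q := by
  have hq : q ∈ Submodule.span R (Set.range (exteriorPower.ιMulti R k (M := V))) := by
    rw [exteriorPower.ιMulti_span]
    trivial
  induction hq using Submodule.span_induction with
  | zero => exact zero
  | add a b _ _ ha hb => exact add a b ha hb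
  | smul r a _ ha => exact smul r a ha
  | mem a ha =>
    obtain ⟨x, rfl⟩ := ha
    exact ιMulti x

theorem ι_mul_eq_neg_one_pow_smul (x : V) {k : ℕ} {b : ExteriorAlgebra R V} (hb : b ∈ ⋀[R]^k V) :
    ExteriorAlgebra.ι R x * b = (-1 : R) ^ k • (b * ExteriorAlgebra.ι R x) := by
  induction hb using Submodule.pow_induction_on_left' with
  | algebraMap r => rw [pow_zero, one_smul, Algebra.commutes]
  | add a b i _ _ ha hb => rw [mul_add, add_mul, ha, hb, smul_add]
  | mem_mul m hm i b _ hb =>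
    obtain ⟨y, rfl⟩ := hm
    rw [← mul_assoc, eq_neg_of_add_eq_zero_left (ExteriorAlgebra.ι_add_mul_swap x y), neg_mul,
      mul_assoc, hb, mul_smul_comm, mul_assoc, pow_succ, mul_neg_one, neg_smul]

theorem mul_eq_neg_one_pow_smul_mul {j k : ℕ} {a b : ExteriorAlgebra R V} (ha : a ∈ ⋀[R]^j V)
    (hb : b ∈ ⋀[R]^k V) : a * b = (-1 : R) ^ (j * k) • (b * a) := by
  induction ha using Submodule.pow_induction_on_left' with
  | algebraMap r => rw [zero_mul, pow_zero, one_smul, Algebra.commutes]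
  | add a c i _ _ ha hc => rw [add_mul, mul_add, ha, hc, smul_add]
  | mem_mul m hm i c _ hc =>
    obtain ⟨y, rfl⟩ := hm
    rw [mul_assoc, hc, mul_smul_comm, ← mul_assoc, ι_mul_eq_neg_one_pow_smul y hb,
      smul_mul_assoc, smul_smul, ← pow_add, mul_assoc, Nat.succ_mul]

end GradedCommutativity

section Wedge

variable {V : Type*} [AddCommGroup V] [Module ℝ V] {W : Type*} [AddCommGroup W] [Module ℝ W]

theorem coe_wedgeRight (j : ℕ) {k : ℕ} (p : ⋀[ℝ]^k V) (q : ⋀[ℝ]^j V) :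
    (wedgeRight j p q : ExteriorAlgebra ℝ V) = q * p := rfl

theorem wedgeRight_zero (j k : ℕ) (q : ⋀[ℝ]^j V) : wedgeRight j (0 : ⋀[ℝ]^k V) q = 0 :=
  Subtype.ext (mul_zero _)

theorem wedgeRight_add (j : ℕ) {k : ℕ} (p p' : ⋀[ℝ]^k V) (q : ⋀[ℝ]^j V) :
    wedgeRight j (p + p') q = wedgeRight j p q + wedgeRight j p' q :=
  Subtype.ext (mul_add _ _ _)

theorem wedgeRight_smul (j : ℕ) {k : ℕ} (r : ℝ) (p : ⋀[ℝ]^k V) (q : ⋀[ℝ]^j V) :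
    wedgeRight j (r • p) q = r • wedgeRight j p q :=
  Subtype.ext (mul_smul_comm _ _ _)

theorem wedgeRight_ιMulti {j k : ℕ} (x : Fin j → V) (y : Fin k → V) :
    wedgeRight j (exteriorPower.ιMulti ℝ k y) (exteriorPower.ιMulti ℝ j x) =
      exteriorPower.ιMulti ℝ (j + k) (Fin.append x y) :=
  Subtype.ext (ExteriorAlgebra.ιMulti_mul_ιMulti x y)

theorem map_wedgeRight (A : V →ₗ[ℝ] W) {j k : ℕ} (p : ⋀[ℝ]^k V) (q : ⋀[ℝ]^j V) :
    exteriorPower.map (j + k) A (wedgeRight j p q) =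
      wedgeRight j (exteriorPower.map k A p) (exteriorPower.map j A q) :=
  Subtype.ext <| by simp only [coe_exteriorPower_map, coe_wedgeRight, map_mul]

end Wedge

section Boundary

variable {L : Type*} [LieRing L] [LieAlgebra ℝ L] {L' : Type*} [LieRing L'] [LieAlgebra ℝ L']

theorem adExt_one (x : L) : adExt x (1 : ExteriorAlgebra ℝ L) = 0 := extendDerivation_one _

theorem adExt_mul (x : L) (a b : ExteriorAlgebra ℝ L) :
    adExt x (a * b) = adExt x a * b + a * adExt x b := by
  induction a using exterior_induction with
  | h1 => simp only [adExt_one, one_mul, zero_mul, zero_add]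
  | hadd a c ha hc => simp only [map_add, add_mul, ha, hc]; abel
  | hsmul s a ha => simp only [map_smul, smul_mul_assoc, ha, smul_add]
  | hmul z a ha => rw [mul_assoc, adExt_ι_mul, ha, adExt_ι_mul]; noncomm_ring

theorem boundary_ι_mul_eq_zero {x : L} {p : ExteriorAlgebra ℝ L} (hp : boundary p = 0)
    (hx : adExt x p = 0) : boundary (ExteriorAlgebra.ι ℝ x * p) = 0 := by
  rw [boundary_ι_mul, hp, hx, mul_zero, neg_zero, sub_zero]

theorem boundary_map_mul (φ : L' →ₗ[ℝ] L) (hφ : ∀ x y, φ ⁅x, y⁆ = ⁅φ x, φ y⁆)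
    {p : ExteriorAlgebra ℝ L} (hp : boundary p = 0) (hφp : ∀ x, adExt (φ x) p = 0)
    (q : ExteriorAlgebra ℝ L') :
    boundary (ExteriorAlgebra.map φ q * p) = ExteriorAlgebra.map φ (boundary q) * p := by
  induction q using exterior_induction with
  | h1 => rw [map_one, one_mul, hp, boundary_one, map_zero, zero_mul]
  | hadd a b ha hb => simp only [map_add, add_mul, ha, hb]
  | hsmul s a ha => simp only [map_smul, smul_mul_assoc, ha]
  | hmul z a ha =>
    rw [map_mul (ExteriorAlgebra.map φ), ExteriorAlgebra.map_apply_ι, mul_assoc, boundary_ι_mul,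
      ha, adExt_mul, hφp, adExt_map φ hφ, boundary_ι_mul, map_sub, map_neg,
      map_mul (ExteriorAlgebra.map φ), ExteriorAlgebra.map_apply_ι]
    noncomm_ring

theorem coe_boundaryAt (k : ℕ) (q : ⋀[ℝ]^(k + 1) L) :
    (boundaryAt k q : ExteriorAlgebra ℝ L) = boundary (q : ExteriorAlgebra ℝ L) := rfl

theorem boundaryAt_zero : (boundaryAt 0 : ⋀[ℝ]^(0 + 1) L →ₗ[ℝ] ⋀[ℝ]^0 L) = 0 := by
  refine exteriorPower.linearMap_ext (AlternatingMap.ext fun x => Subtype.ext ?_)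
  change boundary (ExteriorAlgebra.ιMulti ℝ 1 x) = 0
  rw [ExteriorAlgebra.ιMulti_succ_apply, ExteriorAlgebra.ιMulti_zero_apply]
  exact boundary_ι_mul_eq_zero boundary_one (adExt_one _)

theorem boundary_wedgeRight_ιMulti_one {k : ℕ} {p : ⋀[ℝ]^k L}
    (hp : boundary (p : ExteriorAlgebra ℝ L) = 0) {x : L} (hx : x ∈ isotropyAlgebra p) :
    boundary (wedgeRight 1 p (exteriorPower.ιMulti ℝ 1 fun _ => x) : ExteriorAlgebra ℝ L) = 0 := by
  rw [coe_wedgeRight, exteriorPower.ιMulti_apply_coe, ExteriorAlgebra.ιMulti_succ_apply,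
    ExteriorAlgebra.ιMulti_zero_apply, mul_one]
  exact boundary_ι_mul_eq_zero hp hx

theorem coe_wedgeRight_map_boundaryAt {k : ℕ} {p : ⋀[ℝ]^k L}
    (hp : boundary (p : ExteriorAlgebra ℝ L) = 0) (i : ℕ) (q : ⋀[ℝ]^(i + 1) (isotropyAlgebra p)) :
    (wedgeRight i p (exteriorPower.map i (isotropyAlgebra p).toSubmodule.subtype
      (boundaryAt i q)) : ExteriorAlgebra ℝ L) =
    boundary (wedgeRight (i + 1) p (exteriorPower.map (i + 1)
      (isotropyAlgebra p).toSubmodule.subtype q) : ExteriorAlgebra ℝ L) := by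
  have h := boundary_map_mul (L' := isotropyAlgebra p) (isotropyAlgebra p).toSubmodule.subtype
    (fun _ _ => rfl) hp (fun x => x.2) q
  rw [coe_wedgeRight, coe_wedgeRight, coe_exteriorPower_map, coe_exteriorPower_map, coe_boundaryAt]
  exact h.symm

end Boundary

section Contraction

variable {V : Type*} [AddCommGroup V] [Module ℝ V] [TopologicalSpace V]
  {W : Type*} [AddCommGroup W] [Module ℝ W] [TopologicalSpace W]

theorem contractMulti_zero {N k e : ℕ} (h : k + e = N) (P : ⋀[ℝ]^k V) :
    contractMulti h (0 : V [⋀^Fin N]→L[ℝ] ℝ) P = 0 := by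
  refine LinearMap.congr_fun (g := 0) (exteriorPower.linearMap_ext ?_) P
  ext x w
  exact contractMulti_ιMulti h _ x w

theorem contractMulti_contractMulti {N N' j k e : ℕ} (h : k + N' = N) (h' : j + e = N')
    (h'' : k + j + e = N) (η : V [⋀^Fin N]→L[ℝ] ℝ) (P : ⋀[ℝ]^k V) (Q : ⋀[ℝ]^j V) :
    contractMulti h' (contractMulti h η P) Q = contractMulti h'' η (wedgeRight k Q P) := by
  induction Q using exteriorPower_induction with
  | zero => rw [wedgeRight_zero, map_zero, map_zero]
  | add a b ha hb => rw [map_add, ha, hb, wedgeRight_add, map_add]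
  | smul r a ha => rw [map_smul, ha, wedgeRight_smul, map_smul]
  | ιMulti y =>
    ext w
    rw [contractMulti_ιMulti]
    induction P using exteriorPower_induction with
    | zero => rw [map_zero, map_zero, map_zero]; rfl
    | add a b ha hb => simp only [map_add, ContinuousAlternatingMap.add_apply, ha, hb]
    | smul r a ha => simp only [map_smul, ContinuousAlternatingMap.smul_apply, ha]
    | ιMulti x =>
      subst h' h
      rw [contractMulti_ιMulti, wedgeRight_ιMulti, contractMulti_ιMulti, Fin.append_assoc]
      rfl

theorem contractMulti_eq_smul_of_coe_eq_smul {N a b e : ℕ} (ha : a + e = N) (hb : b + e = N)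
    (η : V [⋀^Fin N]→L[ℝ] ℝ) {c : ℝ} {P : ⋀[ℝ]^a V} {Q : ⋀[ℝ]^b V}
    (h : (P : ExteriorAlgebra ℝ V) = c • (Q : ExteriorAlgebra ℝ V)) :
    contractMulti ha η P = c • contractMulti hb η Q := by
  obtain rfl : a = b := by omega
  obtain rfl : P = c • Q := Subtype.ext h
  rw [map_smul]

theorem contractMulti_contractMulti_swap {N N' j k e : ℕ} (h : k + N' = N) (h' : j + e = N')
    (h'' : j + k + e = N) (η : V [⋀^Fin N]→L[ℝ] ℝ) (P : ⋀[ℝ]^k V) (Q : ⋀[ℝ]^j V) :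
    contractMulti h' (contractMulti h η P) Q =
      (-1 : ℝ) ^ (j * k) • contractMulti h'' η (wedgeRight j P Q) := by
  rw [contractMulti_contractMulti h h' (by omega)]
  refine contractMulti_eq_smul_of_coe_eq_smul _ _ _ ?_
  rw [coe_wedgeRight, coe_wedgeRight, mul_eq_neg_one_pow_smul_mul P.2 Q.2, mul_comm k j]

theorem contractMulti_compContinuousLinearMap {N k e : ℕ} (h : k + e = N) (η : W [⋀^Fin N]→L[ℝ] ℝ)
    (A : V →L[ℝ] W) (P : ⋀[ℝ]^k V) :
    contractMulti h (η.compContinuousLinearMap A) P =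
      (contractMulti h η (exteriorPower.map k (A : V →ₗ[ℝ] W) P)).compContinuousLinearMap A := by
  suffices hP : contractMulti h (η.compContinuousLinearMap A) =
      ContinuousAlternatingMap.compContinuousLinearMapₗ A ∘ₗ contractMulti h η ∘ₗ
        exteriorPower.map k (A : V →ₗ[ℝ] W) from LinearMap.congr_fun hP P
  refine exteriorPower.linearMap_ext (AlternatingMap.ext fun x => ?_)
  ext w
  simp only [LinearMap.compAlternatingMap_apply, LinearMap.comp_apply, contractMulti_ιMulti,
    ContinuousAlternatingMap.compContinuousLinearMapₗ_apply, exteriorPower.map_apply_ιMulti,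
    ContinuousAlternatingMap.compContinuousLinearMap_apply]
  subst h
  congr 1
  exact funext (Fin.addCases (fun i => by simp) fun i => by simp)

end Contraction

section Sign

theorem varsigma_mul_self (k : ℕ) : varsigma k * varsigma k = 1 := by
  simp [varsigma, ← mul_pow]

theorem varsigma_one : varsigma 1 = 1 := by simp [varsigma]

theorem varsigma_add (j k : ℕ) :
    varsigma (j + k) = -(varsigma j * varsigma k * (-1) ^ (j * k)) := by
  have h : (j + k) * (j + k + 1) / 2 = j * (j + 1) / 2 + k * (k + 1) / 2 + j * k := by
    obtain ⟨a, ha⟩ := (Nat.even_mul_succ_self j).two_dvd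
    obtain ⟨b, hb⟩ := (Nat.even_mul_succ_self k).two_dvd
    have hab : (j + k) * (j + k + 1) = 2 * (a + b + j * k) := by linear_combination ha + hb
    simp only [hab, ha, hb, Nat.mul_div_cancel_left _ two_pos]
  rw [varsigma, varsigma, varsigma, h]
  ring

theorem varsigma_mul_varsigma_add (j k : ℕ) :
    varsigma k * varsigma (j + k) = -(varsigma j * (-1) ^ (j * k)) := by
  rw [varsigma_add]
  linear_combination -(varsigma j * (-1) ^ (j * k)) * varsigma_mul_self k

end Sign

/-! ### Exterior derivative -/

section Differential

variable {E : Type*} [NormedAddCommGroup E] [NormedSpace ℝ E]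
  {M : Type*} [TopologicalSpace M] [ChartedSpace E M]
  {F : Type*} [NormedAddCommGroup F] [NormedSpace ℝ F]
  {X : Type*} [TopologicalSpace X] [ChartedSpace F X]
  {H : Type*} [NormedAddCommGroup H] [NormedSpace ℝ H]
  {Y : Type*} [TopologicalSpace Y] [ChartedSpace H Y]

variable (E F) in
/-- The differential of a map of manifolds, as a continuous linear map between the model spaces, to
which the tangent spaces are equal by definition. -/
def differential (φ : X → M) (z : X) : F →L[ℝ] E := mfderiv 𝓘(ℝ, F) 𝓘(ℝ, E) φ z

theorem differential_comp {φ : X → M} {ψ : Y → X} (z : Y)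
    (hφ : MDifferentiableAt 𝓘(ℝ, F) 𝓘(ℝ, E) φ (ψ z))
    (hψ : MDifferentiableAt 𝓘(ℝ, H) 𝓘(ℝ, F) ψ z) :
    differential E H (fun y => φ (ψ y)) z =
      (differential E F φ (ψ z)).comp (differential F H ψ z) :=
  mfderiv_comp (I' := 𝓘(ℝ, F)) z hφ hψ

theorem differential_eq_fderiv (φ : F → E) (z : F) : differential E F φ z = fderiv ℝ φ z :=
  mfderiv_eq_fderiv

variable [IsManifold 𝓘(ℝ, E) ∞ M]

theorem contMDiffAt_extChartAt_symm (m : M) {y : E} (hy : y ∈ (extChartAt 𝓘(ℝ, E) m).target) :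
    ContMDiffAt 𝓘(ℝ, E) 𝓘(ℝ, E) ∞ (extChartAt 𝓘(ℝ, E) m).symm y :=
  (contMDiffOn_extChartAt_symm m).contMDiffAt ((isOpen_extChartAt_target m).mem_nhds hy)

theorem contMDiffAt_extChartAt_of_mem_source (m : M) {m' : M}
    (hm : m' ∈ (extChartAt 𝓘(ℝ, E) m).source) :
    ContMDiffAt 𝓘(ℝ, E) 𝓘(ℝ, E) ∞ (extChartAt 𝓘(ℝ, E) m) m' :=
  contMDiffAt_extChartAt' (by rwa [← extChartAt_source 𝓘(ℝ, E)])

theorem differential_extChartAt_symm_apply_differential (m : M) {m' : M}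
    (hm : m' ∈ (extChartAt 𝓘(ℝ, E) m).source) (u : E) :
    differential E E (extChartAt 𝓘(ℝ, E) m).symm (extChartAt 𝓘(ℝ, E) m m')
      (differential E E (extChartAt 𝓘(ℝ, E) m) m' u) = u := by
  have h := mfderivWithin_extChartAt_symm_comp_mfderiv_extChartAt' (I := 𝓘(ℝ, E)) hm
  rw [ModelWithCorners.range_eq_univ, mfderivWithin_univ] at h
  exact DFunLike.congr_fun h u

theorem differential_extChartAt_apply_differential_symm (m : M) {y : E}
    (hy : y ∈ (extChartAt 𝓘(ℝ, E) m).target) (u : E) :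
    differential E E (extChartAt 𝓘(ℝ, E) m) ((extChartAt 𝓘(ℝ, E) m).symm y)
      (differential E E (extChartAt 𝓘(ℝ, E) m).symm y u) = u := by
  have h := mfderiv_extChartAt_comp_mfderivWithin_extChartAt_symm (I := 𝓘(ℝ, E)) hy
  rw [ModelWithCorners.range_eq_univ, mfderivWithin_univ] at h
  exact DFunLike.congr_fun h u

theorem isLocallyConstant_of_hasMFDerivAt_zero [IsManifold 𝓘(ℝ, F) ∞ X] {u : X → E}
    (hu : ∀ z, HasMFDerivAt 𝓘(ℝ, F) 𝓘(ℝ, E) u z 0) : IsLocallyConstant u := by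
  rw [IsLocallyConstant.iff_eventually_eq]
  intro z
  let χ := extChartAt 𝓘(ℝ, F) z
  have hcomp : ∀ y ∈ χ.target, HasFDerivAt (fun y => u (χ.symm y)) 0 y := fun y hy => by
    have h := (hu (χ.symm y)).comp y
      ((contMDiffAt_extChartAt_symm z hy).mdifferentiableAt (by simp)).hasMFDerivAt
    rw [ContinuousLinearMap.zero_comp] at h
    exact h.hasFDerivAt
  obtain ⟨ε, hε, hball⟩ := Metric.isOpen_iff.1 (isOpen_extChartAt_target (I := 𝓘(ℝ, F)) z) _
    (mem_extChartAt_target z)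
  filter_upwards [(continuousAt_extChartAt (I := 𝓘(ℝ, F)) z).preimage_mem_nhds
    (Metric.ball_mem_nhds _ hε), extChartAt_source_mem_nhds (I := 𝓘(ℝ, F)) z] with z' hz' hs
  have hconst := Metric.isOpen_ball.is_const_of_fderiv_eq_zero
    (convex_ball (χ z) ε).isPreconnected
    (fun y hy => (hcomp y (hball hy)).differentiableAt.differentiableWithinAt)
    (fun y hy => (hcomp y (hball hy)).fderiv) hz' (Metric.mem_ball_self hε)
  exact (congrArg u (χ.left_inv hs)).symm.trans
    (hconst.trans (congrArg u (χ.left_inv (mem_extChartAt_source z))))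

end Differential

section PullbackToModel

variable {E : Type*} [NormedAddCommGroup E] [NormedSpace ℝ E]
  {M : Type*} [TopologicalSpace M] [ChartedSpace E M]
  {H : Type*} [NormedAddCommGroup H] [NormedSpace ℝ H] {d : ℕ}

/-- The value of a form at a point, as a form on the model space, to which the tangent space is
equal by definition. -/
def formAt (α : Form E M d) (m : M) : E [⋀^Fin d]→L[ℝ] ℝ := α m

/-- The pullback of a form on `M` to a normed space, expressed with `differential` so that it takes
values in a fixed space of alternating maps. -/
def pullbackToModel (Φ : H → M) (α : Form E M d) (z : H) : H [⋀^Fin d]→L[ℝ] ℝ :=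
  (formAt α (Φ z)).compContinuousLinearMap (differential E H Φ z)

theorem inChart_eq_pullbackToModel (α : Form E M d) (m : M) :
    inChart α m = pullbackToModel (extChartAt 𝓘(ℝ, E) m).symm α := rfl

theorem pullbackToModel_apply (Φ : H → M) (α : Form E M d) (z : H) (w : Fin d → H) :
    pullbackToModel Φ α z w = formAt α (Φ z) fun i => differential E H Φ z (w i) := rfl

theorem contDiffAt_inChart {α : Form E M d} (hα : IsSmoothForm α) {m : M} {y : E}
    (hy : y ∈ (extChartAt 𝓘(ℝ, E) m).target) : ContDiffAt ℝ ∞ (inChart α m) y :=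
  (hα m).contDiffAt ((isOpen_extChartAt_target m).mem_nhds hy)

theorem contDiffAt_extChartAt_comp {Φ : H → M} {z : H}
    (hΦ : ContMDiffAt 𝓘(ℝ, H) 𝓘(ℝ, E) ∞ Φ z) :
    ContDiffAt ℝ ∞ (fun z' => extChartAt 𝓘(ℝ, E) (Φ z) (Φ z')) z :=
  contMDiffAt_iff_contDiffAt.1 ((contMDiffAt_extChartAt (x := Φ z)).comp z hΦ)

theorem extD_smul (c : ℝ) (α : Form E M d) : extD (c • α) = c • extD α := by
  ext1 m
  have h : inChart (c • α) m = c • inChart α m := rfl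
  rw [extD, h, extDeriv_smul]
  rfl

variable [IsManifold 𝓘(ℝ, E) ∞ M]

theorem pullbackToModel_eventuallyEq {Φ : H → M} {z : H}
    (hΦ : ContMDiffAt 𝓘(ℝ, H) 𝓘(ℝ, E) ∞ Φ z) (α : Form E M d) :
    pullbackToModel Φ α =ᶠ[nhds z] fun z' =>
      (inChart α (Φ z) (extChartAt 𝓘(ℝ, E) (Φ z) (Φ z'))).compContinuousLinearMap
        (fderiv ℝ (fun z' => extChartAt 𝓘(ℝ, E) (Φ z) (Φ z')) z') := by
  filter_upwards [(contMDiffAt_iff_contMDiffAt_nhds (by simp)).1 (hΦ.of_le (m := 1) (by simp)),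
    hΦ.continuousAt.preimage_mem_nhds (extChartAt_source_mem_nhds (I := 𝓘(ℝ, E)) (Φ z))]
    with z' hz' hs
  rw [← differential_eq_fderiv, differential_comp (F := E) z'
    ((contMDiffAt_extChartAt_of_mem_source _ hs).mdifferentiableAt (by simp))
    (hz'.mdifferentiableAt (by simp)), inChart_eq_pullbackToModel]
  ext w
  simp only [pullbackToModel_apply, ContinuousAlternatingMap.compContinuousLinearMap_apply,
    ContinuousLinearMap.coe_comp, Function.comp_def,
    differential_extChartAt_symm_apply_differential _ hs]
  rw [(extChartAt 𝓘(ℝ, E) (Φ z)).left_inv hs]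

theorem differentiableAt_pullbackToModel {Φ : H → M} {z : H}
    (hΦ : ContMDiffAt 𝓘(ℝ, H) 𝓘(ℝ, E) ∞ Φ z) {α : Form E M d} (hα : IsSmoothForm α) :
    DifferentiableAt ℝ (pullbackToModel Φ α) z := by
  refine DifferentiableAt.congr_of_eventuallyEq ?_ (pullbackToModel_eventuallyEq hΦ α)
  have hχ := contDiffAt_extChartAt_comp hΦ
  refine DifferentiableAt.continuousAlternatingMapCompContinuousLinearMap ?_ ?_
  · exact DifferentiableAt.comp z
      ((contDiffAt_inChart hα (mem_extChartAt_target _)).differentiableAt (by simp))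
      (hχ.differentiableAt (by simp))
  · exact (hχ.fderiv_right (m := 1) (by norm_cast)).differentiableAt (by simp)

theorem extDeriv_pullbackToModel {Φ : H → M} {z : H}
    (hΦ : ContMDiffAt 𝓘(ℝ, H) 𝓘(ℝ, E) ∞ Φ z) {α : Form E M d} (hα : IsSmoothForm α) :
    extDeriv (pullbackToModel Φ α) z = pullbackToModel Φ (extD α) z := by
  rw [(pullbackToModel_eventuallyEq hΦ α).extDeriv_eq, extDeriv_pullback
    (f := fun z' => extChartAt 𝓘(ℝ, E) (Φ z) (Φ z'))
    ((contDiffAt_inChart hα (mem_extChartAt_target _)).differentiableAt (by simp))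
    (contDiffAt_extChartAt_comp hΦ)
    (by rw [minSmoothness_of_isRCLikeNormedField]; exact ENat.LEInfty.out),
    ← differential_eq_fderiv, differential_comp (F := E) z
    ((contMDiffAt_extChartAt (n := ∞)).mdifferentiableAt (by simp))
    (hΦ.mdifferentiableAt (by simp))]
  rfl

theorem eqOn_inChart_extD {α : Form E M d} (hα : IsSmoothForm α) (m : M) :
    Set.EqOn (inChart (extD α) m) (extDeriv (inChart α m)) (extChartAt 𝓘(ℝ, E) m).target :=
  fun _ hy => (extDeriv_pullbackToModel (contMDiffAt_extChartAt_symm m hy) hα).symm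

theorem isSmoothForm_extD {α : Form E M d} (hα : IsSmoothForm α) : IsSmoothForm (extD α) := by
  refine fun m => ContDiffOn.congr (fun y hy => ?_) (eqOn_inChart_extD hα m)
  have hfderiv : ContDiffAt ℝ ∞ (fderiv ℝ (inChart α m)) y :=
    (contDiffAt_inChart hα hy).fderiv_right (by norm_cast)
  exact ((ContinuousAlternatingMap.alternatizeUncurryFinCLM ℝ E ℝ).contDiff.contDiffAt.comp y
    hfderiv).contDiffWithinAt

theorem extD_extD {α : Form E M d} (hα : IsSmoothForm α) : extD (extD α) = 0 := by
  ext1 m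
  have h0 : extDeriv (inChart (extD α) m) (extChartAt 𝓘(ℝ, E) m m) = 0 := by
    rw [((eqOn_inChart_extD hα m).eventuallyEq_of_mem (extChartAt_target_mem_nhds m)).extDeriv_eq]
    exact extDeriv_extDeriv_apply (contDiffAt_inChart hα (mem_extChartAt_target m))
      (by rw [minSmoothness_of_isRCLikeNormedField]; exact ENat.LEInfty.out)
  rw [extD, h0]
  rfl

theorem extDeriv_inChart_eq_zero {α : Form E M d} (hα : extD α = 0) (m : M) :
    extDeriv (inChart α m) (extChartAt 𝓘(ℝ, E) m m) = 0 := by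
  have hinv := differential_extChartAt_apply_differential_symm m
    (mem_extChartAt_target (I := 𝓘(ℝ, E)) m)
  rw [extChartAt_to_inv] at hinv
  ext w
  have hw := DFunLike.congr_fun (show (extDeriv (inChart α m)
    (extChartAt 𝓘(ℝ, E) m m)).compContinuousLinearMap
    (differential E E (extChartAt 𝓘(ℝ, E) m) m) = 0 from congrFun hα m) fun i =>
      differential E E (extChartAt 𝓘(ℝ, E) m).symm (extChartAt 𝓘(ℝ, E) m m) (w i)
  simp only [ContinuousAlternatingMap.compContinuousLinearMap_apply, Function.comp_def, hinv] at hw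
  exact hw

end PullbackToModel

section CartanFormula

variable {𝕜 : Type*} [NontriviallyNormedField 𝕜] {E : Type*} [NormedAddCommGroup E]
  [NormedSpace 𝕜 E] {F : Type*} [NormedAddCommGroup F] [NormedSpace 𝕜 F] {V : Type*}
  [NormedAddCommGroup V] [NormedSpace 𝕜 V] {d : ℕ}

theorem hasFDerivAt_curryLeft {Ω : E → E [⋀^Fin (d + 1)]→L[𝕜] V} {z : E}
    (hΩ : DifferentiableAt 𝕜 Ω z) (x : E) :
    HasFDerivAt (fun z => (Ω z).curryLeft x)
      (((ContinuousLinearMap.apply 𝕜 (E [⋀^Fin d]→L[𝕜] V) x).comp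
        ContinuousAlternatingMap.curryLeftLI.toContinuousLinearMap).comp (fderiv 𝕜 Ω z)) z :=
  ((ContinuousLinearMap.apply 𝕜 (E [⋀^Fin d]→L[𝕜] V) x).comp
    ContinuousAlternatingMap.curryLeftLI.toContinuousLinearMap).hasFDerivAt.comp z hΩ.hasFDerivAt

theorem extDeriv_curryLeft_add_curryLeft_extDeriv {Ω : E → E [⋀^Fin (d + 1)]→L[𝕜] V} {z : E}
    (hΩ : DifferentiableAt 𝕜 Ω z) (x : E) :
    extDeriv (fun z => (Ω z).curryLeft x) z + (extDeriv Ω z).curryLeft x = fderiv 𝕜 Ω z x := by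
  have hremoveNth : ∀ (w : Fin (d + 1) → E) (i : Fin (d + 1)),
      i.succ.removeNth (Matrix.vecCons x w : Fin (d + 2) → E) =
        Matrix.vecCons x (i.removeNth w) := fun w i => by
    ext j
    refine Fin.cases ?_ (fun j => ?_) j <;> simp [Fin.removeNth]
  ext w
  rw [ContinuousAlternatingMap.add_apply, ContinuousAlternatingMap.curryLeft_apply_apply, extDeriv,
    extDeriv, (hasFDerivAt_curryLeft hΩ x).fderiv,
    ContinuousAlternatingMap.alternatizeUncurryFin_apply,
    ContinuousAlternatingMap.alternatizeUncurryFin_apply, Fin.sum_univ_succ (n := d + 1)]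
  simp [hremoveNth, pow_succ, Fin.removeNth_zero]

theorem fderiv_slice_eq_zero {Ω : E × F → (E × F) [⋀^Fin (d + 1)]→L[𝕜] V} {y : E} {h x : F}
    (hΩ : DifferentiableAt 𝕜 Ω (y, h)) (hΩ0 : extDeriv Ω (y, h) = 0)
    (hι : extDeriv (fun y' => ((Ω (y', h)).curryLeft (0, x)).compContinuousLinearMap
      (ContinuousLinearMap.inl 𝕜 E F)) y = 0) (w : Fin (d + 1) → E) :
    fderiv 𝕜 (fun h' => Ω (y, h') fun i => (w i, 0)) h x = 0 := by
  have hslice : HasFDerivAt (fun h' => Ω (y, h') fun i => (w i, 0)) _ h :=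
    (hΩ.hasFDerivAt.comp h (hasFDerivAt_prodMk_right y h)).continuousAlternatingMap_apply_const _
  have hinl : ∀ y', fderiv 𝕜 (fun y' : E => (y', h)) y' = ContinuousLinearMap.inl 𝕜 E F :=
    fun y' => (hasFDerivAt_prodMk_left y' h).fderiv
  have hpullback := extDeriv_pullback (r := ⊤) (f := fun y' : E => (y', h))
    (hasFDerivAt_curryLeft hΩ (0, x)).differentiableAt
    (contDiffAt_id.prodMk contDiffAt_const) le_top
  have hcartan := extDeriv_curryLeft_add_curryLeft_extDeriv hΩ (0, x)
  have hzero : (0 : (E × F) [⋀^Fin (d + 2)]→L[𝕜] V).curryLeft (0, x) = 0 := rfl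
  rw [hΩ0, hzero, add_zero] at hcartan
  simp only [hinl, hι, hcartan] at hpullback
  rw [hslice.fderiv]
  exact (DFunLike.congr_fun hpullback w).symm

end CartanFormula

/-! ### Invariance under a Lie group action -/

section Interior

variable {E : Type*} [NormedAddCommGroup E] [NormedSpace ℝ E]
  {M : Type*} [TopologicalSpace M] [ChartedSpace E M]

theorem formAt_interior {d : ℕ} (X : VField E M) (α : Form E M (d + 1)) (m : M) (w : Fin d → E) :
    formAt (interior (Nat.add_comm 1 d) X α) m w = formAt α m (Matrix.vecCons (X m : E) w) := by
  have happend : ∀ x : E, Fin.append (fun _ : Fin 1 => x) w ∘ Fin.cast (Nat.add_comm 1 d).symm =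
      Matrix.vecCons x w := fun x => by
    rw [Fin.append_left_eq_cons]
    rfl
  exact (contractMulti_ιMulti (Nat.add_comm 1 d) (α m) (fun _ => X m) w).trans
    (congrArg (formAt α m) (happend (X m)))

end Interior

section Action

variable {F : Type*} [NormedAddCommGroup F] [NormedSpace ℝ F]
  {G : Type*} [TopologicalSpace G] [ChartedSpace F G] [Group G]
  {E : Type*} [NormedAddCommGroup E] [NormedSpace ℝ E]
  {M : Type*} [TopologicalSpace M] [ChartedSpace E M]

theorem exists_isPreconnected_of_mem_isotropyComponent [LieGroup 𝓘(ℝ, F) ∞ G] [CompleteSpace F]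
    {k : ℕ} (p : ⋀[ℝ]^k (GroupLieAlgebra 𝓘(ℝ, F) G)) {g : G} (hg : g ∈ isotropyComponent p) :
    ∃ s : Set G, IsPreconnected s ∧ 1 ∈ s ∧ g ∈ s := by
  obtain ⟨g, hg, rfl⟩ := hg
  exact ⟨(Subtype.val : isotropyGroup p → G) '' connectedComponent 1,
    isPreconnected_connectedComponent.image _ continuous_subtype_val.continuousOn,
    ⟨1, mem_connectedComponent, rfl⟩, ⟨g, hg, rfl⟩⟩

namespace SmoothRightAction

variable (ϑ : SmoothRightAction F G E M)

theorem contMDiff_orbit (m : M) : ContMDiff 𝓘(ℝ, F) 𝓘(ℝ, E) ∞ (fun g : G => ϑ.act m g) :=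
  ϑ.smooth.comp (contMDiff_const.prodMk contMDiff_id)

theorem contMDiff_translation (g : G) : ContMDiff 𝓘(ℝ, E) 𝓘(ℝ, E) ∞ (fun m : M => ϑ.act m g) :=
  ϑ.smooth.comp (contMDiff_id.prodMk contMDiff_const)

theorem differential_translation_one (m : M) :
    differential E E (fun m => ϑ.act m 1) m = ContinuousLinearMap.id ℝ E := by
  rw [funext ϑ.act_one]
  exact mfderiv_id

theorem infinitesimal_eq_differential (m : M) (x : GroupLieAlgebra 𝓘(ℝ, F) G) :
    ϑ.infinitesimal m x = differential E F (fun g : G => ϑ.act m g) 1 x := rfl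

/-- The action near `(m, 1)`, in the charts of `M` at `m` and of `G` at `1`. It is meaningful on the
product of the targets of these charts. -/
def actInCharts (m : M) (z : E × F) : M :=
  ϑ.act ((extChartAt 𝓘(ℝ, E) m).symm z.1) ((extChartAt 𝓘(ℝ, F) (1 : G)).symm z.2)

theorem actInCharts_extChartAt (m : M) (y : E) {g : G}
    (hg : g ∈ (extChartAt 𝓘(ℝ, F) (1 : G)).source) :
    ϑ.actInCharts m (y, extChartAt 𝓘(ℝ, F) (1 : G) g) =
      ϑ.act ((extChartAt 𝓘(ℝ, E) m).symm y) g := by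
  rw [actInCharts, (extChartAt 𝓘(ℝ, F) (1 : G)).left_inv hg]

variable {d : ℕ}

/-- The function `g ↦ (ϑ_g^* α)_m(w)` on `G`, whose constancy in `g` for all `m` and `w` expresses
the invariance of `α`. The tangent vectors `w` are taken in the model space. -/
def pullbackEval (α : Form E M d) (m : M) (w : Fin d → E) (g : G) : ℝ :=
  formAt α (ϑ.act m g) fun i => differential E E (fun m => ϑ.act m g) m (w i)

theorem pullbackEval_one (α : Form E M d) (m : M) (w : Fin d → E) :
    ϑ.pullbackEval α m w 1 = formAt α m w := by
  rw [pullbackEval, differential_translation_one, ϑ.act_one]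
  rfl

theorem pullbackEval_mul (α : Form E M d) (m : M) (w : Fin d → E) (g l : G) :
    ϑ.pullbackEval α m w (g * l) = ϑ.pullbackEval α (ϑ.act m g)
      (fun i => differential E E (fun m => ϑ.act m g) m (w i)) l := by
  have hcomp := differential_comp (E := E) (F := E) (φ := fun m => ϑ.act m l)
    (ψ := fun m => ϑ.act m g) m ((ϑ.contMDiff_translation l).mdifferentiable (by simp) _)
    ((ϑ.contMDiff_translation g).mdifferentiable (by simp) _)
  rw [pullbackEval, pullbackEval, funext fun m => ϑ.act_mul m g l, hcomp, ϑ.act_mul]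
  rfl

variable [LieGroup 𝓘(ℝ, F) ∞ G]

section Equivariance

variable [CompleteSpace F]

theorem infinitesimal_act (m : M) (g : G) (x : GroupLieAlgebra 𝓘(ℝ, F) G) :
    (ϑ.infinitesimal (ϑ.act m g) x : E) =
      differential E E (fun m => ϑ.act m g) m (ϑ.infinitesimal m (Ad F g x)) := by
  have hconj : (fun h : G => ϑ.act (ϑ.act m g) h) =
      fun h => ϑ.act (ϑ.act m (g * h * g⁻¹)) g := by
    ext h
    simp only [← ϑ.act_mul, inv_mul_cancel_right]
  have hone : g * 1 * g⁻¹ = 1 := by simp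
  have htranslation := differential_comp (E := E) (F := E) (φ := fun m => ϑ.act m g)
    (ψ := fun h : G => ϑ.act m (g * h * g⁻¹)) 1
    ((ϑ.contMDiff_translation g).mdifferentiable (by simp) _)
    (((ϑ.contMDiff_orbit m).comp (contMDiff_conj g)).mdifferentiable (by simp) _)
  have horbit := differential_comp (E := E) (F := F) (φ := fun h : G => ϑ.act m h)
    (ψ := fun h : G => g * h * g⁻¹) 1
    ((ϑ.contMDiff_orbit m).mdifferentiable (by simp) _) (mdifferentiableAt_conj g 1)
  rw [horbit, hone, ϑ.act_one, ← hconj] at htranslation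
  exact DFunLike.congr_fun htranslation x

theorem pullback_contract_multiField {N k e : ℕ} (h : k + e = N) (g : G) (α : Form E M N)
    (p : ⋀[ℝ]^k (GroupLieAlgebra 𝓘(ℝ, F) G)) :
    pullback (fun m => ϑ.act m g) (contract h (multiField ϑ.infinitesimal p) α) =
      contract h (multiField ϑ.infinitesimal (exteriorPower.map k (Ad F g) p))
        (pullback (fun m => ϑ.act m g) α) := by
  ext1 m
  have hv : ϑ.infinitesimal (ϑ.act m g) =
      (mfderiv 𝓘(ℝ, E) 𝓘(ℝ, E) (fun m => ϑ.act m g) m).toLinearMap ∘ₗ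
        (ϑ.infinitesimal m ∘ₗ Ad F g) :=
    LinearMap.ext fun x => ϑ.infinitesimal_act m g x
  have hp : multiField ϑ.infinitesimal p (ϑ.act m g) =
      exteriorPower.map k (mfderiv 𝓘(ℝ, E) 𝓘(ℝ, E) (fun m => ϑ.act m g) m).toLinearMap
        (multiField ϑ.infinitesimal (exteriorPower.map k (Ad F g) p) m) := by
    rw [multiField, hv, exteriorPower.map_comp, exteriorPower.map_comp]
    rfl
  unfold pullback contract
  rw [contractMulti_compContinuousLinearMap, ← hp]

end Equivariance

variable [IsManifold 𝓘(ℝ, E) ∞ M]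

theorem contMDiffAt_actInCharts (m : M) {y : E} {h : F}
    (hy : y ∈ (extChartAt 𝓘(ℝ, E) m).target) (hh : h ∈ (extChartAt 𝓘(ℝ, F) (1 : G)).target) :
    ContMDiffAt 𝓘(ℝ, E × F) 𝓘(ℝ, E) ∞ (ϑ.actInCharts m) (y, h) := by
  refine ContMDiffAt.comp (I' := 𝓘(ℝ, E).prod 𝓘(ℝ, F)) (y, h) ϑ.smooth.contMDiffAt
    (f := fun z : E × F => ((extChartAt 𝓘(ℝ, E) m).symm z.1,
      (extChartAt 𝓘(ℝ, F) (1 : G)).symm z.2)) (ContMDiffAt.prodMk ?_ ?_)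
  · exact ContMDiffAt.comp (I' := 𝓘(ℝ, E)) (y, h) (contMDiffAt_extChartAt_symm m hy)
      contDiff_fst.contMDiff.contMDiffAt
  · exact ContMDiffAt.comp (I' := 𝓘(ℝ, F)) (y, h) (contMDiffAt_extChartAt_symm (1 : G) hh)
      contDiff_snd.contMDiff.contMDiffAt

theorem differential_actInCharts_left (m : M) {y : E} {g : G}
    (hy : y ∈ (extChartAt 𝓘(ℝ, E) m).target) (hg : g ∈ (extChartAt 𝓘(ℝ, F) (1 : G)).source)
    (w : E) :
    differential E (E × F) (ϑ.actInCharts m) (y, extChartAt 𝓘(ℝ, F) (1 : G) g) (w, 0) =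
      differential E E (fun m => ϑ.act m g) ((extChartAt 𝓘(ℝ, E) m).symm y)
        (differential E E (extChartAt 𝓘(ℝ, E) m).symm y w) := by
  have hslice := differential_comp (E := E) (F := E × F) (φ := ϑ.actInCharts m)
    (ψ := fun y => (y, extChartAt 𝓘(ℝ, F) (1 : G) g)) y
    ((ϑ.contMDiffAt_actInCharts m hy
      ((extChartAt 𝓘(ℝ, F) (1 : G)).map_source hg)).mdifferentiableAt (by simp))
    (hasFDerivAt_prodMk_left y _).differentiableAt.mdifferentiableAt
  have htranslation := differential_comp (E := E) (F := E) (φ := fun m => ϑ.act m g)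
    (ψ := (extChartAt 𝓘(ℝ, E) m).symm) y ((ϑ.contMDiff_translation g).mdifferentiable (by simp) _)
    ((contMDiffAt_extChartAt_symm m hy).mdifferentiableAt (by simp))
  rw [funext fun y => ϑ.actInCharts_extChartAt m y hg, htranslation,
    differential_eq_fderiv (fun y => (y, extChartAt 𝓘(ℝ, F) (1 : G) g)),
    (hasFDerivAt_prodMk_left y _).fderiv] at hslice
  exact (DFunLike.congr_fun hslice w).symm

theorem differential_actInCharts_right (m : M) {y : E} (hy : y ∈ (extChartAt 𝓘(ℝ, E) m).target)
    (x : F) :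
    differential E (E × F) (ϑ.actInCharts m) (y, extChartAt 𝓘(ℝ, F) (1 : G) 1)
        (0, differential F F (extChartAt 𝓘(ℝ, F) (1 : G)) 1 x) =
      differential E F (fun g : G => ϑ.act ((extChartAt 𝓘(ℝ, E) m).symm y) g) 1 x := by
  have hact := (ϑ.contMDiffAt_actInCharts m hy
    (mem_extChartAt_target (I := 𝓘(ℝ, F)) (1 : G))).mdifferentiableAt (n := ∞) (by simp)
  have hmk : MDifferentiableAt 𝓘(ℝ, F) 𝓘(ℝ, E × F) (fun h : F => (y, h))
      (extChartAt 𝓘(ℝ, F) (1 : G) 1) :=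
    (hasFDerivAt_prodMk_right y _).differentiableAt.mdifferentiableAt
  have hslice := differential_comp (E := E) (F := E × F) (φ := ϑ.actInCharts m)
    (ψ := fun h => (y, h)) (extChartAt 𝓘(ℝ, F) (1 : G) 1) hact hmk
  have horbit := differential_comp (E := E) (F := F) (φ := fun h => ϑ.actInCharts m (y, h))
    (ψ := extChartAt 𝓘(ℝ, F) (1 : G)) 1 (hact.comp _ hmk)
    ((contMDiffAt_extChartAt (n := ∞)).mdifferentiableAt (by simp))
  have hev : (fun g => ϑ.actInCharts m (y, extChartAt 𝓘(ℝ, F) (1 : G) g)) =ᶠ[nhds 1]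
      fun g => ϑ.act ((extChartAt 𝓘(ℝ, E) m).symm y) g := by
    filter_upwards [extChartAt_source_mem_nhds (I := 𝓘(ℝ, F)) (1 : G)] with g hg
    exact ϑ.actInCharts_extChartAt m y hg
  rw [hslice, differential_eq_fderiv (fun h : F => (y, h)),
    (hasFDerivAt_prodMk_right y _).fderiv] at horbit
  exact (DFunLike.congr_fun (hev.mfderiv_eq.symm.trans horbit) x).symm

theorem pullbackToModel_actInCharts_left (α : Form E M d) (m : M) {y : E} {g : G}
    (hy : y ∈ (extChartAt 𝓘(ℝ, E) m).target) (hg : g ∈ (extChartAt 𝓘(ℝ, F) (1 : G)).source)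
    (w : Fin d → E) :
    pullbackToModel (ϑ.actInCharts m) α (y, extChartAt 𝓘(ℝ, F) (1 : G) g) (fun i => (w i, 0)) =
      ϑ.pullbackEval α ((extChartAt 𝓘(ℝ, E) m).symm y)
        (fun i => differential E E (extChartAt 𝓘(ℝ, E) m).symm y (w i)) g := by
  simp only [pullbackToModel_apply, pullbackEval, ϑ.differential_actInCharts_left m hy hg,
    ϑ.actInCharts_extChartAt m y hg]

theorem pullbackEval_eventuallyEq (α : Form E M d) (m : M) (w : Fin d → E) :
    ϑ.pullbackEval α m w =ᶠ[nhds 1] fun g : G => pullbackToModel (ϑ.actInCharts m) α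
      (extChartAt 𝓘(ℝ, E) m m, extChartAt 𝓘(ℝ, F) (1 : G) g)
      fun i => (differential E E (extChartAt 𝓘(ℝ, E) m) m (w i), 0) := by
  filter_upwards [extChartAt_source_mem_nhds (I := 𝓘(ℝ, F)) (1 : G)] with g hg
  simp only [ϑ.pullbackToModel_actInCharts_left α m (mem_extChartAt_target m) hg,
    differential_extChartAt_symm_apply_differential m (mem_extChartAt_source m), extChartAt_to_inv]

theorem curryLeft_pullbackToModel_actInCharts (α : Form E M (d + 1)) (m : M) {y : E}
    (hy : y ∈ (extChartAt 𝓘(ℝ, E) m).target) (x : GroupLieAlgebra 𝓘(ℝ, F) G) :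
    ((pullbackToModel (ϑ.actInCharts m) α (y, extChartAt 𝓘(ℝ, F) (1 : G) 1)).curryLeft
        (0, differential F F (extChartAt 𝓘(ℝ, F) (1 : G)) 1 x)).compContinuousLinearMap
          (ContinuousLinearMap.inl ℝ E F) =
      inChart (interior (Nat.add_comm 1 d) (fun m => ϑ.infinitesimal m x) α) m y := by
  have hone := mem_extChartAt_source (I := 𝓘(ℝ, F)) (1 : G)
  ext w
  rw [inChart_eq_pullbackToModel, pullbackToModel_apply, formAt_interior,
    infinitesimal_eq_differential, ContinuousAlternatingMap.compContinuousLinearMap_apply,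
    ContinuousAlternatingMap.curryLeft_apply_apply, pullbackToModel_apply,
    ϑ.actInCharts_extChartAt m y hone, ϑ.act_one]
  congr 1
  ext i
  refine Fin.cases (ϑ.differential_actInCharts_right m hy x) (fun i => ?_) i
  refine (ϑ.differential_actInCharts_left m hy hone (w i)).trans ?_
  rw [differential_translation_one]
  rfl

theorem contMDiffAt_actInCharts_extChartAt_one (m : M) :
    ContMDiffAt 𝓘(ℝ, E × F) 𝓘(ℝ, E) ∞ (ϑ.actInCharts m)
      (extChartAt 𝓘(ℝ, E) m m, extChartAt 𝓘(ℝ, F) (1 : G) 1) :=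
  ϑ.contMDiffAt_actInCharts m (mem_extChartAt_target m) (mem_extChartAt_target (1 : G))

theorem fderiv_pullbackToModel_actInCharts_eq_zero {η : Form E M (d + 1)}
    (hη : IsSmoothForm η) (hη' : extD η = 0) {x : GroupLieAlgebra 𝓘(ℝ, F) G}
    (hx : extD (interior (Nat.add_comm 1 d) (fun m => ϑ.infinitesimal m x) η) = 0) (m : M)
    (w : Fin (d + 1) → E) :
    fderiv ℝ (fun h => pullbackToModel (ϑ.actInCharts m) η (extChartAt 𝓘(ℝ, E) m m, h)
        fun i => (w i, 0)) (extChartAt 𝓘(ℝ, F) (1 : G) 1)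
      (differential F F (extChartAt 𝓘(ℝ, F) (1 : G)) 1 x) = 0 := by
  have hact := ϑ.contMDiffAt_actInCharts_extChartAt_one m
  refine fderiv_slice_eq_zero (differentiableAt_pullbackToModel hact hη) ?_ ?_ w
  · rw [extDeriv_pullbackToModel hact hη, hη']
    rfl
  · rw [← extDeriv_inChart_eq_zero hx m]
    refine Filter.EventuallyEq.extDeriv_eq ?_
    filter_upwards [extChartAt_target_mem_nhds (I := 𝓘(ℝ, E)) m] with y hy
    exact ϑ.curryLeft_pullbackToModel_actInCharts η m hy x

theorem hasMFDerivAt_pullbackEval_one {η : Form E M (d + 1)}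
    (hη : IsSmoothForm η) (hη' : extD η = 0)
    (hx : ∀ x, extD (interior (Nat.add_comm 1 d) (fun m => ϑ.infinitesimal m x) η) = 0)
    (m : M) (w : Fin (d + 1) → E) :
    HasMFDerivAt 𝓘(ℝ, F) 𝓘(ℝ, ℝ) (ϑ.pullbackEval η m w) 1 0 := by
  have hact := ϑ.contMDiffAt_actInCharts_extChartAt_one m
  have hslice : DifferentiableAt ℝ (fun h => pullbackToModel (ϑ.actInCharts m) η
      (extChartAt 𝓘(ℝ, E) m m, h) fun i => (differential E E (extChartAt 𝓘(ℝ, E) m) m (w i), 0))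
      (extChartAt 𝓘(ℝ, F) (1 : G) 1) :=
    (((differentiableAt_pullbackToModel hact hη).hasFDerivAt.comp _
      (hasFDerivAt_prodMk_right _ _)).continuousAlternatingMap_apply_const _).differentiableAt
  have hchart : MDifferentiableAt 𝓘(ℝ, F) 𝓘(ℝ, F) (extChartAt 𝓘(ℝ, F) (1 : G)) 1 :=
    (contMDiffAt_extChartAt (n := ∞)).mdifferentiableAt (by simp)
  have hcomp := (hslice.hasFDerivAt.hasMFDerivAt.comp 1 hchart.hasMFDerivAt).congr_of_eventuallyEq
    (ϑ.pullbackEval_eventuallyEq η m w)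
  refine hcomp.congr_mfderiv (ContinuousLinearMap.ext fun x => ?_)
  exact ϑ.fderiv_pullbackToModel_actInCharts_eq_zero hη hη' (hx x) m _

theorem hasMFDerivAt_pullbackEval {η : Form E M (d + 1)}
    (hη : IsSmoothForm η) (hη' : extD η = 0)
    (hx : ∀ x, extD (interior (Nat.add_comm 1 d) (fun m => ϑ.infinitesimal m x) η) = 0)
    (m : M) (w : Fin (d + 1) → E) (g : G) :
    HasMFDerivAt 𝓘(ℝ, F) 𝓘(ℝ, ℝ) (ϑ.pullbackEval η m w) g 0 := by
  have htranslate : ϑ.pullbackEval η m w = fun l => ϑ.pullbackEval η (ϑ.act m g)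
      (fun i => differential E E (fun m => ϑ.act m g) m (w i)) (g⁻¹ * l) := by
    ext l
    rw [← pullbackEval_mul, mul_inv_cancel_left]
  have hone := ϑ.hasMFDerivAt_pullbackEval_one hη hη' hx (ϑ.act m g)
    fun i => differential E E (fun m => ϑ.act m g) m (w i)
  rw [← inv_mul_cancel g] at hone
  have hmul : MDifferentiableAt 𝓘(ℝ, F) 𝓘(ℝ, F) (fun l : G => g⁻¹ * l) g :=
    (contMDiff_mul_left (n := ∞)).mdifferentiable (by simp) _
  have hcomp := hone.comp g hmul.hasMFDerivAt
  rw [ContinuousLinearMap.zero_comp] at hcomp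
  rw [htranslate]
  exact hcomp

theorem isLocallyConstant_pullbackEval {η : Form E M (d + 1)}
    (hη : IsSmoothForm η) (hη' : extD η = 0)
    (hx : ∀ x, extD (interior (Nat.add_comm 1 d) (fun m => ϑ.infinitesimal m x) η) = 0)
    (m : M) (w : Fin (d + 1) → E) : IsLocallyConstant (ϑ.pullbackEval η m w) :=
  isLocallyConstant_of_hasMFDerivAt_zero (ϑ.hasMFDerivAt_pullbackEval hη hη' hx m w)

theorem pullback_eq_of_isPreconnected {η : Form E M (d + 1)}
    (hη : IsSmoothForm η) (hη' : extD η = 0)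
    (hx : ∀ x, extD (interior (Nat.add_comm 1 d) (fun m => ϑ.infinitesimal m x) η) = 0)
    {s : Set G} (hs : IsPreconnected s) (h1 : (1 : G) ∈ s) {g : G} (hg : g ∈ s) :
    pullback (fun m => ϑ.act m g) η = η := by
  ext m w
  exact ((ϑ.isLocallyConstant_pullbackEval hη hη' hx m w).apply_eq_of_isPreconnected
    hs hg h1).trans (ϑ.pullbackEval_one η m w)

theorem pullback_contract_multiField_of_mem_isotropyComponent [CompleteSpace F]
    {η : Form E M (d + 1)} (hη : IsSmoothForm η) (hη' : extD η = 0)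
    (hx : ∀ x, extD (interior (Nat.add_comm 1 d) (fun m => ϑ.infinitesimal m x) η) = 0)
    {k e : ℕ} (h : k + e = d + 1) (p : ⋀[ℝ]^k (GroupLieAlgebra 𝓘(ℝ, F) G)) {g : G}
    (hg : g ∈ isotropyComponent p) :
    pullback (fun m => ϑ.act m g) (contract h (multiField ϑ.infinitesimal p) η) =
      contract h (multiField ϑ.infinitesimal p) η := by
  obtain ⟨s, hs, hone, hgs⟩ := exists_isPreconnected_of_mem_isotropyComponent p hg
  have hp : exteriorPower.map k (Ad F g) p = p := isotropyComponent_le p hg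
  rw [pullback_contract_multiField, hp, ϑ.pullback_eq_of_isPreconnected hη hη' hx hs hone hgs]

end SmoothRightAction

end Action

/-! ### Co-momentum maps and cycles -/

section CoMomentum

variable {E : Type*} [NormedAddCommGroup E] [NormedSpace ℝ E]
  {M : Type*} [TopologicalSpace M] [ChartedSpace E M]
  {L : Type*} [LieRing L] [LieAlgebra ℝ L]
  {v : ∀ m : M, L →ₗ[ℝ] TangentSpace 𝓘(ℝ, E) m}

theorem extD_zero {d : ℕ} : extD (0 : Form E M d) = 0 := by
  have h := extD_smul (0 : ℝ) (0 : Form E M d)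
  rwa [zero_smul, zero_smul] at h

theorem interior_zero {N e : ℕ} (h : 1 + e = N) (X : VField E M) :
    interior h X (0 : Form E M N) = 0 :=
  funext fun _ => contractMulti_zero h _

theorem contract_multiField_ιMulti_one {N e : ℕ} (h : 1 + e = N) (x : L) (α : Form E M N) :
    contract h (multiField v (exteriorPower.ιMulti ℝ 1 fun _ => x)) α =
      interior h (fun m => v m x) α :=
  funext fun m => congrArg (contractMulti h (α m)) (exteriorPower.map_apply_ιMulti (v m) _)

theorem contract_restrictAction_contract {N N' j k e : ℕ} (h : k + N' = N) (h' : j + e = N')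
    (h'' : j + k + e = N) (η : Form E M N) (S : LieSubalgebra ℝ L) (p : ⋀[ℝ]^k L) (q : ⋀[ℝ]^j S) :
    contract h' (multiField (restrictAction S v) q) (contract h (multiField v p) η) =
      (-1 : ℝ) ^ (j * k) • contract h''
        (multiField v (wedgeRight j p (exteriorPower.map j S.toSubmodule.subtype q))) η := by
  ext1 m
  have hpq : multiField v (wedgeRight j p (exteriorPower.map j S.toSubmodule.subtype q)) m =
      wedgeRight j (multiField v p m) (multiField (restrictAction S v) q m) := by
    unfold multiField restrictAction
    rw [map_wedgeRight, exteriorPower.map_comp]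
    rfl
  exact (contractMulti_contractMulti_swap h h' h'' (η m) _ _).trans (by rw [← hpq]; rfl)

section Components

variable {n k r : ℕ} (hkr : k + r = n) {p : ⋀[ℝ]^k L} {f : Components E M L n}

theorem inducedComponents_succ_apply (j d : ℕ) (h : j + 1 + d = r)
    (q : ⋀[ℝ]^(j + 1) (isotropyAlgebra p)) :
    (inducedComponents hkr p f (j + 1) d h q : Form E M d) =
      -varsigma k • (f (j + 1 + k) d (by omega) (wedgeRight (j + 1) p
        (exteriorPower.map (j + 1) (isotropyAlgebra p).toSubmodule.subtype q)) : Form E M d) := rfl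

theorem inducedComponents_boundaryAt (i d : ℕ) (h : i + d = r)
    (q : ⋀[ℝ]^(i + 1) (isotropyAlgebra p)) :
    (inducedComponents hkr p f i d h (boundaryAt i q) : Form E M d) =
      -varsigma k • (f (i + k) d (by omega) (wedgeRight i p
        (exteriorPower.map i (isotropyAlgebra p).toSubmodule.subtype (boundaryAt i q))) :
          Form E M d) := by
  cases i with
  | zero =>
    rw [boundaryAt_zero]
    simp only [LinearMap.zero_apply, map_zero, Submodule.coe_zero, smul_zero]
  | succ j => rfl

theorem isEquivariant_inducedComponents {K K' : Type*} {ρ : K → M → M} {A : K → L →ₗ[ℝ] L}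
    (hf : IsEquivariant ρ A f) (κ : K' → K)
    (B : K' → isotropyAlgebra p →ₗ[ℝ] isotropyAlgebra p)
    (hp : ∀ g, exteriorPower.map k (A (κ g)) p = p) (hB : ∀ g x, (B g x : L) = A (κ g) x) :
    IsEquivariant (fun g => ρ (κ g)) B (inducedComponents hkr p f) := by
  intro g i d h hi q
  obtain ⟨j, rfl⟩ := Nat.exists_eq_add_of_le' hi
  have hBq : exteriorPower.map (j + 1) (isotropyAlgebra p).toSubmodule.subtype
      (exteriorPower.map (j + 1) (B g) q) = exteriorPower.map (j + 1) (A (κ g))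
        (exteriorPower.map (j + 1) (isotropyAlgebra p).toSubmodule.subtype q) := by
    rw [← LinearMap.comp_apply, ← LinearMap.comp_apply, ← exteriorPower.map_comp,
      ← exteriorPower.map_comp]
    exact congrArg (exteriorPower.map (j + 1) · q) (LinearMap.ext (hB g))
  have hfq := hf (κ g) (j + 1 + k) d (by omega) (by omega) (wedgeRight (j + 1) p
    (exteriorPower.map (j + 1) (isotropyAlgebra p).toSubmodule.subtype q))
  rw [map_wedgeRight, hp, ← hBq] at hfq
  rw [inducedComponents_succ_apply, inducedComponents_succ_apply, ← hfq]
  rfl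

end Components

variable [IsManifold 𝓘(ℝ, E) ∞ M] {n : ℕ} {η : Form E M (n + 1)}
  {f : Components E M L n}

theorem IsMultisymplecticAction.extD_interior_eq_zero (hv : IsMultisymplecticAction v η)
    (hη : extD η = 0) (x : L) :
    extD (interior (Nat.add_comm 1 n) (fun m => v m x) η) = 0 := by
  have h := hv.lieDerivative_eq_zero x
  rwa [lieDerivative, hη, interior_zero, add_zero] at h

theorem IsLInftyMorphism.main_of_coe_eq_boundary (hf : IsLInftyMorphism v η f) {a b d : ℕ}
    (hab : a + 1 = b) (h : b + d = n) (q : ⋀[ℝ]^b L) (q' : ⋀[ℝ]^a L)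
    (hq : (q' : ExteriorAlgebra ℝ L) = boundary (q : ExteriorAlgebra ℝ L)) :
    -(f a (d + 1) (by omega) q' : Form E M (d + 1)) =
      extD (f b d h q : Form E M d) +
        varsigma b • contract (h ▸ rfl) (multiField v q) η := by
  subst hab
  obtain rfl : q' = boundaryAt a q := Subtype.ext hq
  exact hf.main a d h q

theorem IsLInftyMorphism.top_of_coe_eq_boundary (hf : IsLInftyMorphism v η f) {a b : ℕ}
    (ha : a + 0 = n) (hb : b + 0 = n + 1) (q : ⋀[ℝ]^b L) (q' : ⋀[ℝ]^a L)
    (hq : (q' : ExteriorAlgebra ℝ L) = boundary (q : ExteriorAlgebra ℝ L)) :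
    -(f a 0 ha q' : Form E M 0) = varsigma b • contract hb (multiField v q) η := by
  obtain rfl : a = n := by omega
  obtain rfl : b = a + 1 := by omega
  obtain rfl : q' = boundaryAt a q := Subtype.ext hq
  exact hf.top q

section Cycle

variable {b : ℕ} {q : ⋀[ℝ]^b L} (hq : boundary (q : ExteriorAlgebra ℝ L) = 0)

include hq

theorem IsLInftyMorphism.contract_eq_extD (hf : IsLInftyMorphism v η f) (hb : 1 ≤ b) {d : ℕ}
    (h : b + d = n) :
    contract (h ▸ rfl) (multiField v q) η = -varsigma b • extD (f b d h q : Form E M d) := by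
  have hmain := hf.main_of_coe_eq_boundary (Nat.sub_add_cancel hb) h q 0 hq.symm
  rw [map_zero, Submodule.coe_zero, neg_zero] at hmain
  rw [eq_neg_of_add_eq_zero_left hmain.symm, neg_smul_neg, smul_smul, varsigma_mul_self, one_smul]

theorem IsLInftyMorphism.contract_eq_zero (hf : IsLInftyMorphism v η f) (h : b + 0 = n + 1) :
    contract h (multiField v q) η = 0 := by
  have htop := hf.top_of_coe_eq_boundary rfl h q 0 hq.symm
  rw [map_zero, Submodule.coe_zero, neg_zero] at htop
  rw [← one_smul ℝ (contract h _ η), ← varsigma_mul_self b, mul_smul, ← htop, smul_zero]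

theorem IsLInftyMorphism.extD_contract_eq_zero (hf : IsLInftyMorphism v η f) (hb : 1 ≤ b) {e : ℕ}
    (h : b + e = n + 1) : extD (contract h (multiField v q) η) = 0 := by
  cases e with
  | zero => rw [hf.contract_eq_zero hq, extD_zero]
  | succ d =>
    rw [hf.contract_eq_extD hq hb (by omega), extD_smul, extD_extD (f b d _ q).2, smul_zero]

theorem IsLInftyMorphism.isPrePlectic_contract (hf : IsLInftyMorphism v η f) (hb : 1 ≤ b) {r : ℕ}
    (h : b + (r + 1) = n + 1) : IsPrePlectic r (contract h (multiField v q) η) where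
  smooth := by
    rw [hf.contract_eq_extD hq hb (by omega)]
    exact Submodule.smul_mem _ _ (isSmoothForm_extD (f b r _ q).2)
  closed := hf.extD_contract_eq_zero hq hb h

end Cycle

section Induced

variable {k r : ℕ} (hkr : k + r = n) {p : ⋀[ℝ]^k L} (hf : IsLInftyMorphism v η f)
  (hp : boundary (p : ExteriorAlgebra ℝ L) = 0)

include hf hp

theorem inducedComponents_main (i d : ℕ) (h : i + 1 + d = r)
    (q : ⋀[ℝ]^(i + 1) (isotropyAlgebra p)) :
    -(inducedComponents hkr p f i (d + 1) (by omega) (boundaryAt i q) : Form E M (d + 1)) =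
      extD (inducedComponents hkr p f (i + 1) d h q : Form E M d) +
        varsigma (i + 1) • contract (by omega) (multiField (restrictAction (isotropyAlgebra p) v) q)
          (contract (hkr ▸ rfl) (multiField v p) η : Form E M (r + 1)) := by
  have hmain := hf.main_of_coe_eq_boundary (by omega) (by omega) _ _
    (coe_wedgeRight_map_boundaryAt hp i q) (d := d)
  rw [inducedComponents_boundaryAt, inducedComponents_succ_apply,
    ← smul_neg (A := Form E M (d + 1)), hmain, extD_smul,
    contract_restrictAction_contract _ _ (by omega), smul_add, smul_smul, smul_smul, neg_mul,
    varsigma_mul_varsigma_add, neg_neg]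

theorem inducedComponents_top (q : ⋀[ℝ]^(r + 1) (isotropyAlgebra p)) :
    -(inducedComponents hkr p f r 0 rfl (boundaryAt r q) : Form E M 0) =
      varsigma (r + 1) • contract rfl (multiField (restrictAction (isotropyAlgebra p) v) q)
        (contract (hkr ▸ rfl) (multiField v p) η) := by
  have htop := hf.top_of_coe_eq_boundary (by omega) (by omega) _ _
    (coe_wedgeRight_map_boundaryAt hp r q)
  rw [inducedComponents_boundaryAt, ← smul_neg (A := Form E M 0), htop,
    contract_restrictAction_contract _ _ (by omega), smul_smul, smul_smul, neg_mul,
    varsigma_mul_varsigma_add, neg_neg]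

theorem extD_inducedComponents_one (d : ℕ) (h : 1 + d = r) (x : isotropyAlgebra p) :
    extD (inducedComponents hkr p f 1 d h (exteriorPower.ιMulti ℝ 1 fun _ => x) : Form E M d) =
      -interior (by omega) (fun m => restrictAction (isotropyAlgebra p) v m x)
        (contract (hkr ▸ rfl) (multiField v p) η : Form E M (r + 1)) := by
  have hmain := inducedComponents_main hkr hf hp 0 d h (exteriorPower.ιMulti ℝ 1 fun _ => x)
  rw [boundaryAt_zero, LinearMap.zero_apply, map_zero, Submodule.coe_zero, neg_zero,
    varsigma_one, one_smul] at hmain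
  rw [← contract_multiField_ιMulti_one]
  exact eq_neg_of_add_eq_zero_left hmain.symm

theorem extD_interior_contract_eq_zero (x : isotropyAlgebra p) :
    extD (interior (Nat.add_comm 1 r) (fun m => restrictAction (isotropyAlgebra p) v m x)
      (contract (hkr ▸ rfl) (multiField v p) η)) = 0 := by
  rw [← contract_multiField_ιMulti_one, contract_restrictAction_contract _ _ (by omega), extD_smul,
    exteriorPower.map_apply_ιMulti]
  have hcycle := boundary_wedgeRight_ιMulti_one hp x.2
  exact (congrArg _ (hf.extD_contract_eq_zero hcycle (Nat.le_add_right 1 k) _)).trans (smul_zero _)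

end Induced

theorem IsCoMomentumMap.isCoMomentumMap_inducedComponents (hf : IsCoMomentumMap v η f) {k r : ℕ}
    (hk : 1 ≤ k) (hkr : k + r = n) {p : ⋀[ℝ]^k L} (hp : boundary (p : ExteriorAlgebra ℝ L) = 0) :
    IsCoMomentumMap (restrictAction (isotropyAlgebra p) v)
      (contract (hkr ▸ rfl) (multiField v p) η) (inducedComponents hkr p f) where
  action :=
    { smooth x := hf.action.smooth x
      map_lie x y m := hf.action.map_lie x y m
      lieDerivative_eq_zero x := by
        rw [lieDerivative, extD_interior_contract_eq_zero hkr hf.morphism hp,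
          hf.morphism.extD_contract_eq_zero hp hk, interior_zero, add_zero] }
  morphism :=
    { zero _ _ := rfl
      hamiltonian d h q := by
        obtain ⟨x, rfl⟩ := (exteriorPower.oneEquiv ℝ _).symm.surjective q
        rw [exteriorPower.oneEquiv_symm_apply]
        exact ⟨_, hf.action.smooth x, extD_inducedComponents_one hkr hf.morphism hp d h x⟩
      main := inducedComponents_main hkr hf.morphism hp
      top := inducedComponents_top hkr hf.morphism hp }
  momentum := extD_inducedComponents_one hkr hf.morphism hp

end CoMomentum

end
end Multisymplectic

open scoped Manifold ContDiff in
open Multisymplectic in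
theorem mainTheorem10_general
    {E : Type*} [NormedAddCommGroup E] [NormedSpace ℝ E]
    {M : Type*} [TopologicalSpace M] [ChartedSpace E M] [IsManifold 𝓘(ℝ, E) ∞ M]
    {F : Type*} [NormedAddCommGroup F] [NormedSpace ℝ F] [CompleteSpace F]
    {G : Type*} [TopologicalSpace G] [ChartedSpace F G] [Group G] [LieGroup 𝓘(ℝ, F) ∞ G]
    (ϑ : SmoothRightAction F G E M)
    (n k r : ℕ) (hk : 1 ≤ k) (hkr : k + r = n)
    (η : Form E M (n + 1)) (hη : IsPrePlectic n η)
    (f : Components E M (GroupLieAlgebra 𝓘(ℝ, F) G) n)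
    (hf : IsCoMomentumMap ϑ.infinitesimal η f)
    (p : ⋀[ℝ]^k (GroupLieAlgebra 𝓘(ℝ, F) G))
    (hp : boundary (p : ExteriorAlgebra ℝ (GroupLieAlgebra 𝓘(ℝ, F) G)) = 0)
    (ηp : Form E M (r + 1))
    (hηp : ηp = contract (hkr ▸ rfl) (multiField ϑ.infinitesimal p) η) :
    IsPrePlectic r ηp ∧
    (∀ g ∈ isotropyComponent p, pullback (fun m => ϑ.act m g) ηp = ηp) ∧
    IsCoMomentumMap (restrictAction (isotropyAlgebra p) ϑ.infinitesimal) ηp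
      (inducedComponents hkr p f) ∧
    (IsEquivariant (fun g m => ϑ.act m g) (Ad F) f →
      IsEquivariant (fun (g : isotropyComponent p) m => ϑ.act m g) (isotropyAd p)
        (inducedComponents hkr p f)) := by
  subst hηp
  have hη_invariant := hf.action.extD_interior_eq_zero hη.closed
  refine ⟨hf.morphism.isPrePlectic_contract hp hk _, fun g hg => ?_,
    hf.isCoMomentumMap_inducedComponents hk hkr hp, fun hequivariant => ?_⟩
  · exact ϑ.pullback_contract_multiField_of_mem_isotropyComponent hη.smooth hη.closed
      hη_invariant _ p hg
  · exact isEquivariant_inducedComponents hkr hequivariant Subtype.val (isotropyAd p)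
      (fun g => isotropyComponent_le p g.2) fun _ _ => rfl

open scoped Manifold ContDiff in
open Multisymplectic in
theorem mainTheorem10
    {E : Type*} [NormedAddCommGroup E] [NormedSpace ℝ E] [FiniteDimensional ℝ E]
    {M : Type*} [TopologicalSpace M] [ChartedSpace E M] [IsManifold 𝓘(ℝ, E) ∞ M]
    {F : Type*} [NormedAddCommGroup F] [NormedSpace ℝ F] [FiniteDimensional ℝ F] [CompleteSpace F]
    {G : Type*} [TopologicalSpace G] [ChartedSpace F G] [Group G] [LieGroup 𝓘(ℝ, F) ∞ G]
    (ϑ : SmoothRightAction F G E M)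
    (n k r : ℕ) (hk : 1 ≤ k) (hkr : k + r = n)
    (η : Form E M (n + 1)) (hη : IsPrePlectic n η)
    (f : Components E M (GroupLieAlgebra 𝓘(ℝ, F) G) n)
    (hf : IsCoMomentumMap ϑ.infinitesimal η f)
    (p : ⋀[ℝ]^k (GroupLieAlgebra 𝓘(ℝ, F) G))
    (hp : boundary (p : ExteriorAlgebra ℝ (GroupLieAlgebra 𝓘(ℝ, F) G)) = 0)
    (ηp : Form E M (r + 1))
    (hηp : ηp = contract (by omega) (multiField ϑ.infinitesimal p) η) :
    IsPrePlectic r ηp ∧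
    (∀ g ∈ isotropyComponent p, pullback (fun m => ϑ.act m g) ηp = ηp) ∧
    IsCoMomentumMap (restrictAction (isotropyAlgebra p) ϑ.infinitesimal) ηp
      (inducedComponents hkr p f) ∧
    (IsEquivariant (fun g m => ϑ.act m g) (Ad F) f →
      IsEquivariant (fun (g : isotropyComponent p) m => ϑ.act m g) (isotropyAd p)
        (inducedComponents hkr p f)) :=
  mainTheorem10_general ϑ n k r hk hkr η hη f hf p hp ηp hηp
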